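/- Setting. Nodes $0,1,\dots,m$ form a chain. At each time step $i\in\{1,\dots,n\}$ every node $j<m$ sends one bit to node $j+1$ through a binary symmetric channel with crossover probability $p$; all channel uses are independent. Node $0$ knows a message $w\in\{0,1\}^k$; for $1\le j\le m-1$ the bit sent by node $j$ at time $i$ depends only on what it received before time $i$; after $n$ steps node $m$ outputs an estimate $\hat w$ of $w$. Block code. To $b$ blocks of equal length, $\lceil\log_2 b\rceil+1$ redundancy blocks are appended bit by bit: for $b\ge 3$ by the systematic Hamming code shortened to $b$ data bits (unneeded redundancy blocks are zero), with syndrome decoding, so that any one corrupted block is corrected; for $b\le 2$ by one block equal to the sum modulo $2$ of the data blocks and otherwise zero blocks, and then the data blocks are read off without correction. Recursive code. Put $t_l=(l+2)^2$, $b_l=\lfloor (l+2)^2/4\rfloor$, $T_l=\prod_{i=1}^l t_i$, $k_l=\prod_{i=1}^l b_i$, $n_l=\prod_{i=1}^l(b_i+\lceil\log_2 b_i\rceil+1)$. Level-$0$ encoding and decoding is the identity on one bit. The level-$l$ encoder cuts $k_l$ bits into $b_l$ blocks of length $k_{l-1}$, appends redundancy blocks by the block code, and encodes every block at level $l-1$,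 giving $n_l$ bits. The level-$l$ decoder cuts $n_l$ bits into $b_l+\lceil\log_2 b_l\rceil+1$ blocks, decodes each at level $l-1$, and then applies the decoder of the block code. Protocol with $r$ repetitions. The level of a relay node $j\in\{1,\dots,m-1\}$ is the largest $l$ with $T_l\mid j$. Let $L'$ be the largest level of a relay node, let $L$ be given by $k_L\le k<k_{L+1}$, and put $D=\max\{L,L'\}$. Node $0$ pads $w$ with zeros, cuts it into $\lceil k/k_D\rceil$ blocks of $k_D$ bits, encodes each at level $D$, and sends the resulting $N=\lceil k/k_D\rceil\, n_D$ bits one after the other. A level-$l$ relay node reads successive blocks of $n_l$ bits, decodes each at level $l$, encodes the result again at level $l$, and sends the $n_l$ bits; it starts to send as soon as its first block of $n_l$ bits has arrived, and ignores what it receives before its predecessor has started to send. Node $m$ decodes each block of $n_D$ bits at level $D$ and drops the padding. Throughout, every bit is sent $r$ times in a row and the receiver replaces each group of $r$ received bits by their majority vote. The total transmission time is $n=r\big(\sum_{j=1}^{m-1}n_{l(j)}+N\big)$, where $l(j)$ is the level of node $j$. Claim. For every fixed $p\in(0,\tfrac12)$ there is an integer $r\ge 1$ such that, in the limit $m\to\infty$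 with $k=\Theta(m)$, this protocol has total transmission time $n=\mathcal O(m)$ and error probability at most $\exp\!\big(-n^{\Theta(1/\log\log n)}\big)$. That is, for all $0<\alpha\le\beta$ there are $C,c>0$ and $M$ such that for all $m\ge M$, all $k$ with $\alpha m\le k\le\beta m$, and every message $w\in\{0,1\}^k$ (hence also for a random message), $$n\le C\,m\qquad\text{and}\qquad \Pr[\hat w\ne w]\le\exp\!\big(-n^{\,c/\log\log n}\big).$$ -/

import Mathlib

namespace ManyHop

/-! ## Relaying over a chain of binary symmetric channels -/

/-- A deterministic protocol sending a `k`-bit message from node `0` to node `m` in `n` time steps.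
Times are numbered `0, …, n - 1`.  Node `0` sends `encode w i` at time `i`; a node `j ≥ 1` sends at
time `i` the bit `relay j i h`, where `h` holds exactly the `i` bits that it received at the
times `0, …, i - 1`; the last node forms its estimate from the `n` bits that it received. -/
structure Protocol (k n : ℕ) where
  encode : (Fin k → Bool) → ℕ → Bool
  relay : ℕ → (i : ℕ) → (Fin i → Bool) → Bool
  decode : (Fin n → Bool) → Fin k → Bool

/-- The bit `X_{i,j}` that node `j` sends to node `j + 1` at time `i`, when the message is `w` and
`z j i` is the noise bit (`true` for a flip) of the channel from `j` to `j + 1` at time `i`. -/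
def Protocol.sent {k n : ℕ} (P : Protocol k n) (w : Fin k → Bool) (z : ℕ → ℕ → Bool) :
    ℕ → ℕ → Bool
  | 0, i => P.encode w i
  | j + 1, i => P.relay (j + 1) i fun s => Bool.xor (P.sent w z j s) (z j s)

/-- The bit `Y_{i,j}` that node `j + 1` receives from node `j` at time `i`. -/
def Protocol.received {k n : ℕ} (P : Protocol k n) (w : Fin k → Bool) (z : ℕ → ℕ → Bool)
    (j i : ℕ) : Bool :=
  Bool.xor (P.sent w z j i) (z j i)

/-- The estimate of the message formed by node `m`. -/
def Protocol.estimate {k n : ℕ} (P : Protocol k n) (m : ℕ) (w : Fin k → Bool)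
    (z : ℕ → ℕ → Bool) : Fin k → Bool :=
  P.decode fun i => P.received w z (m - 1) i

/-- Noise bits of `m` channels over `n` time steps, as a doubly indexed family (the values outside
the range are never used). -/
def extendNoise {m n : ℕ} (z : Fin m × Fin n → Bool) (j i : ℕ) : Bool :=
  if h : j < m ∧ i < n then z (⟨j, h.1⟩, ⟨i, h.2⟩) else false

/-- The law of the noise: all bits are independent and equal `true` with probability `p`. -/
noncomputable def noiseLaw (p : unitInterval) (m n : ℕ) :
    MeasureTheory.Measure (Fin m × Fin n → Bool) :=
  MeasureTheory.Measure.pi fun _ => ProbabilityTheory.bernoulliMeasure true false p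

/-- The probability that node `m` does not recover the message `w`. -/
noncomputable def Protocol.errorProb {k n : ℕ} (P : Protocol k n) (p : unitInterval) (m : ℕ)
    (w : Fin k → Bool) : ℝ :=
  (noiseLaw p m n).real {z | P.estimate m w (extendNoise z) ≠ w}

/-! ## The block code: shortened Hamming codes -/

/-- The number `⌈log₂ b⌉ + 1` of redundancy symbols added to `b` symbols. -/
def redundancy (b : ℕ) : ℕ := Nat.clog 2 b + 1

/-- The label of the `j`-th data position (`j = 0, 1, …`): the `j`-th positive integer that is not
a power of two, i.e. `3, 5, 6, 7, 9, …`. -/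
noncomputable def dataLabel (j : ℕ) : ℕ := Nat.nth (fun x => 0 < x ∧ ∀ i : ℕ, x ≠ 2 ^ i) j

/-- The label of a position of a codeword: data positions come first, and the `i`-th redundancy
position has label `2 ^ i`.  The binary digits of the labels are the columns of the
parity-check matrix. -/
noncomputable def label (b a : ℕ) : ℕ := if a < b then dataLabel a else 2 ^ (a - b)

/-- The sum modulo 2, over the positions `a < N` whose label has a digit `1` in place `i`, of the
bits `y a`. -/
noncomputable def parityCheck (b N : ℕ) (y : ℕ → Bool) (i : ℕ) : Bool :=
  decide (Odd (((Finset.range N).filter fun a => y a = true ∧ (label b a).testBit i = true).card))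

/-- Encoding of `b` bits into `b + redundancy b` bits.  For `b ≥ 3` this is the systematic
Hamming code, shortened to `b` data bits; if it needs fewer than `redundancy b` redundant bits, the
remaining ones are zero.  For `b ≤ 2` there is one redundant bit, the sum modulo 2 of the data bits,
and the remaining ones are zero. -/
noncomputable def blockEncode (b : ℕ) (d : ℕ → Bool) (a : ℕ) : Bool :=
  if a < b then d a
  else if b ≤ 2 then
    decide (a = b ∧ Odd (((Finset.range b).filter fun j => d j = true).card))
  else parityCheck b b d (a - b)

/-- Decoding, on the assumption that at most one of the `b + redundancy b` bits was changed.  For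
`b ≥ 3` the data bit `j` is flipped exactly if the syndrome is its label.  For `b ≤ 2` the
redundancy does not allow for a correction, and the data bits are taken as they are. -/
noncomputable def blockDecode (b : ℕ) (y : ℕ → Bool) (j : ℕ) : Bool :=
  if b ≤ 2 then y j
  else Bool.xor (y j)
    (decide (∀ i < redundancy b,
      parityCheck b (b + redundancy b) y i = (label b j).testBit i))

/-! ## The recursive code -/

/-- `t_l = (l + 2)²`. -/
def tSeq (l : ℕ) : ℕ := (l + 2) ^ 2

/-- `b_l = ⌊(l + 2)² / 4⌋`. -/
def bSeq (l : ℕ) : ℕ := (l + 2) ^ 2 / 4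

/-- `T_l = t_1 ⋯ t_l`. -/
def tProd (l : ℕ) : ℕ := ∏ i ∈ Finset.Icc 1 l, tSeq i

/-- `k_l = b_1 ⋯ b_l`, the number of message bits of a level-`l` block. -/
def msgLen (l : ℕ) : ℕ := ∏ i ∈ Finset.Icc 1 l, bSeq i

/-- `n_l = ∏_{i ≤ l} (b_i + ⌈log₂ b_i⌉ + 1)`, the number of coded bits of a level-`l` block. -/
def codeLen (l : ℕ) : ℕ := ∏ i ∈ Finset.Icc 1 l, (bSeq i + redundancy (bSeq i))

/-- The level-`l` encoder.  It maps `k_l` bits (the values at `0, …, k_l - 1`) to `n_l` bits.  At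
level `l + 1` the input is cut into `b_{l+1}` blocks of `k_l` bits, redundancy blocks are
appended bit by bit, and each block is encoded at level `l`. -/
noncomputable def levelEncode : ℕ → (ℕ → Bool) → ℕ → Bool
  | 0, x => x
  | l + 1, x => fun q =>
      levelEncode l
        (fun s => blockEncode (bSeq (l + 1)) (fun j => x (j * msgLen l + s)) (q / codeLen l))
        (q % codeLen l)

/-- The level-`l` decoder.  It maps `n_l` bits to `k_l` bits.  At level `l + 1` the input is cut
into `b_{l+1} + ⌈log₂ b_{l+1}⌉ + 1` blocks of `n_l` bits, each is decoded at level `l`, and the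
results are decoded bit by bit. -/
noncomputable def levelDecode : ℕ → (ℕ → Bool) → ℕ → Bool
  | 0, y => y
  | l + 1, y => fun s =>
      blockDecode (bSeq (l + 1))
        (fun a => levelDecode l (fun q => y (a * codeLen l + q)) (s % msgLen l))
        (s / msgLen l)

/-! ## The multi-hop protocol -/

/-- The level of a node `j ≥ 1`: the largest `l` such that `T_l` divides `j`. -/
def level (j : ℕ) : ℕ := Nat.findGreatest (fun l => tProd l ∣ j) j

/-- `L'`: the largest level of a relay node `1, …, m - 1`. -/
def maxRelayLevel (m : ℕ) : ℕ := (Finset.Icc 1 (m - 1)).sup level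

/-- `L`: the level with `k_L ≤ k < k_{L+1}`. -/
def msgLevel (k : ℕ) : ℕ := Nat.findGreatest (fun l => msgLen l ≤ k) k

/-- `max {L, L'}`: the level at which node `0` encodes and node `m` decodes. -/
def endLevel (m k : ℕ) : ℕ := max (msgLevel k) (maxRelayLevel m)

/-- The number `⌈k / k_D⌉` of blocks, `D = endLevel m k`, into which the zero-padded message is
cut (one block if `0 < k < k_{L'}`). -/
def numBlocks (m k : ℕ) : ℕ := (k + msgLen (endLevel m k) - 1) / msgLen (endLevel m k)

/-- The number of bits sent by every node, before repetition. -/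
def streamLen (m k : ℕ) : ℕ := numBlocks m k * codeLen (endLevel m k)

/-- The time at which node `j` starts to send, when each bit is repeated `r` times: a relay node of
level `l` first waits for `r * n_l` bits. -/
def startTime (r j : ℕ) : ℕ := ∑ i ∈ Finset.Icc 1 j, r * codeLen (level i)

/-- The total transmission time: the last node starts to receive when node `m - 1` starts to
send. -/
def transmissionTime (r m k : ℕ) : ℕ := startTime r (m - 1) + r * streamLen m k

/-- Majority vote over the bits `f 0, …, f (r - 1)`. -/
def majority (r : ℕ) (f : ℕ → Bool) : Bool :=
  decide (r < 2 * ((Finset.range r).filter fun e => f e = true).card)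

/-- The bits obtained from the received sequence `y` by ignoring what comes before time `s` and
taking a majority vote over each group of `r` consecutive bits from then on. -/
def votes (r s : ℕ) (y : ℕ → Bool) (q : ℕ) : Bool := majority r fun e => y (s + r * q + e)

/-- The bit stream sent by the encoder (before repetition): the message, padded with
zeros, encoded block by block at level `endLevel m k`. -/
noncomputable def sourceStream (m k : ℕ) (w : Fin k → Bool) (q : ℕ) : Bool :=
  levelEncode (endLevel m k)
    (fun s =>
      let x := q / codeLen (endLevel m k) * msgLen (endLevel m k) + s
      if h : x < k then w ⟨x, h⟩ else false)
    (q % codeLen (endLevel m k))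

/-- What a relay node of level `l` makes of the bit stream `u`: each block of `n_l` bits is decoded
and encoded again. -/
noncomputable def relayStream (l : ℕ) (u : ℕ → Bool) (q : ℕ) : Bool :=
  levelEncode l (levelDecode l fun s => u (q / codeLen l * codeLen l + s)) (q % codeLen l)

/-- A bit stream `u` of length `N`, sent from time `s` on with each bit repeated `r` times; zeros
are sent at all other times. -/
def transmit (r N s : ℕ) (u : ℕ → Bool) (i : ℕ) : Bool :=
  if s ≤ i ∧ i < s + r * N then u ((i - s) / r) else false

/-- The multi-bit protocol over `m` hops with `r` repetitions. -/
noncomputable def multiBit (r m k : ℕ) : Protocol k (transmissionTime r m k) where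
  encode w := transmit r (streamLen m k) 0 (sourceStream m k w)
  relay j i h :=
    transmit r (streamLen m k) (startTime r j)
      (relayStream (level j)
        (votes r (startTime r (j - 1)) fun s => if hs : s < i then h ⟨s, hs⟩ else false)) i
  decode y x :=
    let D := endLevel m k
    let u := votes r (startTime r (m - 1)) fun s =>
      if hs : s < transmissionTime r m k then y ⟨s, hs⟩ else false
    levelDecode D (fun q => u (x / msgLen D * codeLen D + q)) (x % msgLen D)

end ManyHop

namespace ManyHop

/-! ## The block code -/

/-! The proof separates a deterministic statement about error sets from a probability recursion.
`Fails E l j q` is defined from the wrong votes `E` alone. A level-`(l+1)` block fails over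
`T_{l+1}` hops if too many of its sub-blocks each fail on at least one of the `t_{l+1}` segments of
`T_l` hops. The nodes between two such segments have level exactly `l`, so they clean each sub-block
separately. A sub-block that fails nowhere therefore arrives intact, and the Hamming code repairs
the single one that may not (`blockDecode_of_card_lt`, `segmentDecodes`). The whole chain has at
most `T_{D+1}` hops, so it consists of at most `t_{D+1}` segments of level `D` (`decode_last`).

Distinct sub-blocks use disjoint sets of channel uses, so two failures cost the square of one:
`δ_{l+1} ≤ (l+3)^8 δ_l^2` for `l ≥ 1`. At level 1, where `b_1 = 2` and nothing is corrected, only a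
union bound is available. A large constant `r` makes `δ_1` small enough for the recursion to give
`δ_l ≤ exp(-2^l)`, with polynomial room for the final union bound (`measureReal_fails_le`,
`union_bound_le`).

Time is linear for two reasons. Nodes of level at least `l` have density `1 / T_l` and `n_l ≤ 2^{-l}
T_l`, so the waiting times sum to `O(m)` (`sum_codeLen_level_le`). The relative redundancies are
summable, so `n_l / k_l` stays bounded (`exists_codeLen_le`). Finally `m ≤ T_{D+1} = D^{O(D)}` makes
`D` at least of order `log n / log log n`, so `2^D` is at least `n^{c / log log n}`. -/

theorem infinite_not_two_pow :
    (Set.ofPred fun x : ℕ => 0 < x ∧ ∀ i : ℕ, x ≠ 2 ^ i).Infinite := by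
  refine Set.infinite_of_injective_forall_mem (f := fun n : ℕ => 2 * n + 3) (fun a b h => ?_)
    fun n => ?_
  · simpa using h
  · change 0 < 2 * n + 3 ∧ ∀ i : ℕ, 2 * n + 3 ≠ 2 ^ i
    refine ⟨by omega, fun i h => ?_⟩
    rcases i with _ | i
    · simp at h
    · rw [pow_succ] at h
      omega

theorem dataLabel_mem (j : ℕ) : 0 < dataLabel j ∧ ∀ i : ℕ, dataLabel j ≠ 2 ^ i :=
  Nat.nth_mem_of_infinite infinite_not_two_pow j

theorem dataLabel_injective : Function.Injective dataLabel :=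
  Nat.nth_injective infinite_not_two_pow

/-- Below `2 ^ R` only `0` and the `R` powers `2 ^ 0, …, 2 ^ (R - 1)` are excluded. -/
theorem two_pow_le_count_add (R : ℕ) [DecidablePred fun x : ℕ => 0 < x ∧ ∀ i : ℕ, x ≠ 2 ^ i] :
    2 ^ R ≤ Nat.count (fun x : ℕ => 0 < x ∧ ∀ i : ℕ, x ≠ 2 ^ i) (2 ^ R) + (R + 1) := by
  rw [Nat.count_eq_card_filter_range]
  set A := (Finset.range (2 ^ R)).filter fun x : ℕ => 0 < x ∧ ∀ i : ℕ, x ≠ 2 ^ i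
  have hsub : Finset.range (2 ^ R) ⊆ A ∪ insert 0 ((Finset.range R).image fun i => 2 ^ i) := by
    intro x hx
    by_cases h : x ∈ A
    · exact Finset.mem_union_left _ h
    · refine Finset.mem_union_right _ ?_
      simp only [A, Finset.mem_filter, hx, true_and, not_and, not_forall, not_not] at h
      rcases Nat.eq_zero_or_pos x with rfl | h0
      · simp
      · obtain ⟨i, hi⟩ := h h0
        refine Finset.mem_insert_of_mem (Finset.mem_image.2 ⟨i, ?_, hi.symm⟩)
        rw [Finset.mem_range] at hx ⊢
        rw [hi] at hx
        exact (Nat.pow_lt_pow_iff_right (by norm_num)).1 hx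
  calc 2 ^ R = (Finset.range (2 ^ R)).card := by simp
    _ ≤ _ := Finset.card_le_card hsub
    _ ≤ _ := Finset.card_union_le _ _
    _ ≤ A.card + (R + 1) := by
      gcongr
      refine (Finset.card_insert_le _ _).trans ?_
      gcongr
      exact Finset.card_image_le.trans (by simp)

/-- With `c = ⌈log₂ b⌉ ≥ 2` there are at least `2^{c+1} - c - 2 ≥ 2^c ≥ b` data labels of `c + 1`
digits. For `b = 2` the digits do not suffice, whence the separate treatment of `b ≤ 2`. -/
theorem dataLabel_lt {b j : ℕ} (hb : 3 ≤ b) (hj : j < b) : dataLabel j < 2 ^ redundancy b := by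
  classical
  refine Nat.nth_lt_of_lt_count ?_
  have h1 := two_pow_le_count_add (redundancy b)
  have h2 : b ≤ 2 ^ Nat.clog 2 b := Nat.le_pow_clog (by norm_num) b
  have h3 : 2 ≤ Nat.clog 2 b := by
    by_contra h
    have : 2 ^ Nat.clog 2 b ≤ 2 ^ 1 := Nat.pow_le_pow_right (by norm_num) (by omega)
    omega
  have h4 : ∀ c, 2 ≤ c → c + 2 ≤ 2 ^ c := fun c hc => by
    induction c, hc using Nat.le_induction with
    | base => norm_num
    | succ c _ ih => rw [pow_succ]; omega
  have h5 := h4 _ h3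
  have h6 : 2 ^ redundancy b = 2 * 2 ^ Nat.clog 2 b := by rw [redundancy, pow_succ, mul_comm]
  have h7 : redundancy b = Nat.clog 2 b + 1 := rfl
  omega

theorem label_of_lt {b a : ℕ} (h : a < b) : label b a = dataLabel a := if_pos h

theorem label_add (b i : ℕ) : label b (b + i) = 2 ^ i := by
  rw [label, if_neg (by omega), Nat.add_sub_cancel_left]

theorem label_lt {b a : ℕ} (hb : 3 ≤ b) (ha : a < b + redundancy b) :
    label b a < 2 ^ redundancy b := by
  by_cases h : a < b
  · rw [label_of_lt h]
    exact dataLabel_lt hb h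
  · obtain ⟨i, rfl⟩ := Nat.exists_eq_add_of_le (not_lt.1 h)
    rw [label_add]
    exact Nat.pow_lt_pow_right (by norm_num) (by omega)

theorem label_eq_iff {b a j : ℕ} (hj : j < b) : label b a = label b j ↔ a = j := by
  refine ⟨fun h => ?_, fun h => h ▸ rfl⟩
  rw [label_of_lt hj] at h
  by_cases ha : a < b
  · rw [label_of_lt ha] at h
    exact dataLabel_injective h
  · rw [label, if_neg ha] at h
    exact absurd h.symm ((dataLabel_mem j).2 _)

theorem testBit_label_eq_iff {b a j : ℕ} (hb : 3 ≤ b) (ha : a < b + redundancy b) (hj : j < b) :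
    (∀ i < redundancy b, (label b a).testBit i = (label b j).testBit i) ↔ a = j := by
  refine ⟨fun h => (label_eq_iff hj).1 (Nat.eq_of_testBit_eq fun i => ?_), fun h i _ => h ▸ rfl⟩
  by_cases hi : i < redundancy b
  · exact h i hi
  · have h2 : 2 ^ redundancy b ≤ 2 ^ i := Nat.pow_le_pow_right (by norm_num) (not_lt.1 hi)
    rw [Nat.testBit_lt_two_pow ((label_lt hb ha).trans_le h2),
      Nat.testBit_lt_two_pow ((label_lt hb (hj.trans_le (Nat.le_add_right _ _))).trans_le h2)]

theorem parityCheck_zero (b : ℕ) (y : ℕ → Bool) (i : ℕ) : parityCheck b 0 y i = false := by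
  simp [parityCheck]

theorem parityCheck_succ (b N : ℕ) (y : ℕ → Bool) (i : ℕ) :
    parityCheck b (N + 1) y i =
      Bool.xor (parityCheck b N y i) (y N && (label b N).testBit i) := by
  unfold parityCheck
  rw [Finset.range_add_one, Finset.filter_insert]
  by_cases h : y N = true ∧ (label b N).testBit i = true
  · rw [if_pos h, Finset.card_insert_of_notMem (by simp), h.1, h.2]
    by_cases ho : Odd ((Finset.range N).filter fun a =>
      y a = true ∧ (label b a).testBit i = true).card <;> simp [Nat.odd_add_one, ho]
  · rw [if_neg h]
    have : (y N && (label b N).testBit i) = false := by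
      rw [← Bool.not_eq_true, Bool.and_eq_true]; exact h
    rw [this]; simp

theorem parityCheck_congr {b N : ℕ} {y y' : ℕ → Bool} (h : ∀ a < N, y a = y' a) (i : ℕ) :
    parityCheck b N y i = parityCheck b N y' i := by
  induction N with
  | zero => simp [parityCheck_zero]
  | succ N ih =>
    rw [parityCheck_succ, parityCheck_succ, ih fun a ha => h a (by omega), h N (by omega)]

theorem parityCheck_flip {b N a₀ : ℕ} {y y' : ℕ → Bool} (h : ∀ a < N, a ≠ a₀ → y a = y' a)
    (h0 : y a₀ = !y' a₀) (i : ℕ) :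
    parityCheck b N y i =
      Bool.xor (parityCheck b N y' i) (decide (a₀ < N) && (label b a₀).testBit i) := by
  induction N with
  | zero => simp [parityCheck_zero]
  | succ N ih =>
    rw [parityCheck_succ, parityCheck_succ, ih fun a ha => h a (by omega)]
    by_cases hN : N = a₀
    · subst hN
      rw [h0]
      cases y' N <;> cases (label b N).testBit i <;> cases parityCheck b N y' i <;> simp
    · rw [h N (by omega) hN]
      have : (a₀ < N + 1) ↔ a₀ < N := by omega
      simp only [this]
      cases parityCheck b N y' i <;> cases (y' N && (label b N).testBit i) <;> simp

theorem blockEncode_of_lt {b a : ℕ} (d : ℕ → Bool) (h : a < b) : blockEncode b d a = d a :=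
  if_pos h

/-- The redundancy position `b + i` has label `2 ^ i`, so it enters check `i` and no other. -/
theorem parityCheck_blockEncode_add {b : ℕ} (d : ℕ → Bool) (n i : ℕ) :
    parityCheck b (b + n) (blockEncode b d) i =
      Bool.xor (parityCheck b b d i) (decide (i < n) && blockEncode b d (b + i)) := by
  induction n with
  | zero => simpa using parityCheck_congr (fun a ha => blockEncode_of_lt d ha) i
  | succ n ih =>
    rw [← add_assoc, parityCheck_succ, ih, label_add, Nat.testBit_two_pow]
    rcases lt_trichotomy i n with h | rfl | h
    · simp [h, h.ne', Nat.lt_succ_of_lt h]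
    · simp
    · simp [h.ne, not_lt.2 h.le, show ¬ i < n + 1 by omega]

theorem syndrome_blockEncode {b i : ℕ} (hb : 3 ≤ b) (d : ℕ → Bool) (hi : i < redundancy b) :
    parityCheck b (b + redundancy b) (blockEncode b d) i = false := by
  rw [parityCheck_blockEncode_add]
  simp [hi, blockEncode, show ¬ b ≤ 2 by omega]

/-- The Hamming code corrects one error. -/
theorem blockDecode_of_eq_off {b j a₀ : ℕ} (hb : 3 ≤ b) (d y : ℕ → Bool)
    (ha₀ : a₀ < b + redundancy b)
    (h : ∀ a < b + redundancy b, a ≠ a₀ → y a = blockEncode b d a) (hj : j < b) :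
    blockDecode b y j = d j := by
  rw [blockDecode, if_neg (by omega)]
  have hjlt : j < b + redundancy b := by omega
  by_cases h0 : y a₀ = blockEncode b d a₀
  · have hall : ∀ a < b + redundancy b, y a = blockEncode b d a := fun a ha => by
      by_cases e : a = a₀
      · rw [e, h0]
      · exact h a ha e
    have hne : ¬ ∀ i < redundancy b,
        parityCheck b (b + redundancy b) y i = (label b j).testBit i := by
      intro hs
      -- Without corruption the syndrome is zero, and data labels are positive.
      refine (dataLabel_mem j).1.ne' (Nat.eq_of_testBit_eq fun i => ?_)
      rw [Nat.zero_testBit, ← label_of_lt hj]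
      by_cases hi : i < redundancy b
      · rw [← hs i hi, parityCheck_congr hall, syndrome_blockEncode hb d hi]
      · exact Nat.testBit_lt_two_pow ((label_lt hb hjlt).trans_le
          (Nat.pow_le_pow_right (by norm_num) (not_lt.1 hi)))
    rw [hall j hjlt, blockEncode_of_lt d hj]
    simp [hne]
  · have h0' : y a₀ = !blockEncode b d a₀ := by
      revert h0; cases y a₀ <;> cases blockEncode b d a₀ <;> simp
    have hs : ∀ i < redundancy b,
        parityCheck b (b + redundancy b) y i = (label b a₀).testBit i := fun i hi => by
      rw [parityCheck_flip h h0', syndrome_blockEncode hb d hi]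
      simp [ha₀]
    -- The syndrome is the label of the corrupted position. If that is a redundancy position, the
    -- label is a power of two, which no data position carries, and nothing is flipped.
    have hiff : (∀ i < redundancy b,
        parityCheck b (b + redundancy b) y i = (label b j).testBit i) ↔ a₀ = j := by
      rw [← testBit_label_eq_iff hb ha₀ hj]
      exact forall₂_congr fun i hi => by rw [hs i hi]
    by_cases e : a₀ = j
    · subst e
      rw [decide_eq_true (hiff.2 rfl), h0', blockEncode_of_lt d hj]
      simp
    · rw [decide_eq_false (mt hiff.1 e), h j hjlt (Ne.symm e), blockEncode_of_lt d hj]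
      simp

/-- The number of corrupted symbols from which on decoding of the block code may fail. -/
def errorThreshold (b : ℕ) : ℕ := if b ≤ 2 then 1 else 2

theorem blockDecode_of_card_lt {b j : ℕ} (d y : ℕ → Bool) (G : ℕ → Prop) [DecidablePred G]
    (h : ∀ a < b + redundancy b, ¬ G a → y a = blockEncode b d a)
    (hG : ((Finset.range (b + redundancy b)).filter G).card < errorThreshold b) (hj : j < b) :
    blockDecode b y j = d j := by
  unfold errorThreshold at hG
  by_cases hb : b ≤ 2
  · rw [if_pos hb, Nat.lt_one_iff, Finset.card_eq_zero] at hG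
    rw [blockDecode, if_pos hb, h j (by omega) fun hg => ?_, blockEncode_of_lt d hj]
    have : j ∈ (Finset.range (b + redundancy b)).filter G := by
      simp only [Finset.mem_filter, Finset.mem_range]; exact ⟨by omega, hg⟩
    rw [hG] at this
    simp at this
  · rw [if_neg hb] at hG
    have hcard := Finset.card_le_one.1 (Nat.lt_succ_iff.1 hG)
    by_cases he : ∃ a₀ < b + redundancy b, G a₀
    · obtain ⟨a₀, ha₀, hg⟩ := he
      refine blockDecode_of_eq_off (by omega) d y ha₀ (fun a ha hne => h a ha fun hga => hne ?_) hj
      exact hcard a (by simp [ha, hga]) a₀ (by simp [ha₀, hg])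
    · push Not at he
      exact blockDecode_of_eq_off (a₀ := 0) (by omega) d y (by omega)
        (fun a ha _ => h a ha (he a ha)) hj

theorem blockEncode_congr {b : ℕ} {d d' : ℕ → Bool} (h : ∀ j < b, d j = d' j) (a : ℕ) :
    blockEncode b d a = blockEncode b d' a := by
  have hf : (Finset.range b).filter (fun j => d j = true) =
      (Finset.range b).filter fun j => d' j = true :=
    Finset.filter_congr fun j hj => by rw [h j (Finset.mem_range.1 hj)]
  unfold blockEncode
  rw [hf, parityCheck_congr h]
  split_ifs with h1
  · exact h a h1
  · rfl
  · rfl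

theorem blockDecode_congr {b j : ℕ} {y y' : ℕ → Bool}
    (h : ∀ a < b + redundancy b, y a = y' a) (hj : j < b) :
    blockDecode b y j = blockDecode b y' j := by
  unfold blockDecode
  rw [h j (by omega)]
  simp_rw [parityCheck_congr h]

/-! ## The recursive code -/

/-- The number of level-`(l - 1)` blocks in a level-`l` block. -/
def numSub (l : ℕ) : ℕ := bSeq l + redundancy (bSeq l)

theorem tProd_zero : tProd 0 = 1 := by simp [tProd]
theorem msgLen_zero : msgLen 0 = 1 := by simp [msgLen]
theorem codeLen_zero : codeLen 0 = 1 := by simp [codeLen]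

theorem tProd_succ (l : ℕ) : tProd (l + 1) = tSeq (l + 1) * tProd l := by
  rw [tProd, Finset.prod_Icc_succ_top (by omega), mul_comm]; rfl

theorem msgLen_succ (l : ℕ) : msgLen (l + 1) = bSeq (l + 1) * msgLen l := by
  rw [msgLen, Finset.prod_Icc_succ_top (by omega), mul_comm]; rfl

theorem codeLen_succ (l : ℕ) : codeLen (l + 1) = numSub (l + 1) * codeLen l := by
  rw [codeLen, Finset.prod_Icc_succ_top (by omega), mul_comm]; rfl

theorem two_le_bSeq (l : ℕ) : 2 ≤ bSeq (l + 1) := by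
  unfold bSeq
  have : 3 ^ 2 ≤ (l + 1 + 2) ^ 2 := Nat.pow_le_pow_left (by omega) 2
  omega

theorem four_le_bSeq {l : ℕ} (hl : 2 ≤ l) : 4 ≤ bSeq l := by
  unfold bSeq
  have : 16 ≤ (l + 2) ^ 2 := by nlinarith
  omega

theorem redundancy_le {b : ℕ} (hb : 1 ≤ b) : redundancy b ≤ b := by
  have : Nat.clog 2 b ≤ b - 1 := by
    refine Nat.clog_le_of_le_pow ?_
    have := (b - 1).lt_two_pow_self
    omega
  unfold redundancy
  omega

/-- The factor `1/4` in `b_l` pays here: the redundancy at most doubles `b_l ≤ t_l / 4`. The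
remaining factor 2 per level makes the waiting times a geometric series. -/
theorem two_mul_numSub_le (l : ℕ) : 2 * numSub (l + 1) ≤ tSeq (l + 1) := by
  have h1 := redundancy_le (show 1 ≤ bSeq (l + 1) by have := two_le_bSeq l; omega)
  have h2 : 4 * bSeq (l + 1) ≤ tSeq (l + 1) := Nat.mul_div_le _ _
  unfold numSub
  omega

theorem numSub_pos (l : ℕ) : 0 < numSub (l + 1) := by
  have := two_le_bSeq l
  unfold numSub
  omega

theorem tSeq_ge (l : ℕ) : 9 ≤ tSeq (l + 1) :=
  Nat.pow_le_pow_left (show 3 ≤ l + 1 + 2 by omega) 2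

theorem codeLen_pos (l : ℕ) : 0 < codeLen l := by
  induction l with
  | zero => simp [codeLen_zero]
  | succ l ih => rw [codeLen_succ]; exact Nat.mul_pos (numSub_pos l) ih

theorem two_pow_le_msgLen (l : ℕ) : 2 ^ l ≤ msgLen l := by
  induction l with
  | zero => simp [msgLen_zero]
  | succ l ih =>
    rw [msgLen_succ, pow_succ, mul_comm]; exact Nat.mul_le_mul (two_le_bSeq l) ih

theorem msgLen_pos (l : ℕ) : 0 < msgLen l := (by positivity : 0 < 2 ^ l).trans_le (two_pow_le_msgLen l)

theorem two_pow_le_tProd (l : ℕ) : 2 ^ l ≤ tProd l := by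
  induction l with
  | zero => simp [tProd_zero]
  | succ l ih =>
    rw [tProd_succ, pow_succ, mul_comm]
    exact Nat.mul_le_mul (by have := tSeq_ge l; omega) ih

theorem tProd_pos (l : ℕ) : 0 < tProd l := (by positivity : 0 < 2 ^ l).trans_le (two_pow_le_tProd l)

theorem tProd_dvd {l l' : ℕ} (h : l ≤ l') : tProd l ∣ tProd l' := by
  induction l', h using Nat.le_induction with
  | base => exact dvd_rfl
  | succ n _ ih => rw [tProd_succ]; exact ih.mul_left _

theorem codeLen_dvd {l l' : ℕ} (h : l ≤ l') : codeLen l ∣ codeLen l' := by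
  induction l', h using Nat.le_induction with
  | base => exact dvd_rfl
  | succ n _ ih => rw [codeLen_succ]; exact ih.mul_left _

theorem msgLen_dvd {l l' : ℕ} (h : l ≤ l') : msgLen l ∣ msgLen l' := by
  induction l', h using Nat.le_induction with
  | base => exact dvd_rfl
  | succ n _ ih => rw [msgLen_succ]; exact ih.mul_left _

theorem levelEncode_congr {l : ℕ} {x x' : ℕ → Bool} (h : ∀ s < msgLen l, x s = x' s) {q : ℕ}
    (hq : q < codeLen l) : levelEncode l x q = levelEncode l x' q := by
  induction l generalizing x x' q with
  | zero =>
    rw [codeLen_zero, Nat.lt_one_iff] at hq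
    exact h q (by simp [hq, msgLen_zero])
  | succ l ih =>
    refine ih (fun s hs => blockEncode_congr (fun j hj => h _ ?_) _)
      (Nat.mod_lt _ (codeLen_pos l))
    rw [msgLen_succ]
    calc j * msgLen l + s < (j + 1) * msgLen l := by rw [add_mul]; omega
      _ ≤ _ := Nat.mul_le_mul_right _ hj

theorem levelDecode_congr {l : ℕ} {y y' : ℕ → Bool} (h : ∀ q < codeLen l, y q = y' q) {s : ℕ}
    (hs : s < msgLen l) : levelDecode l y s = levelDecode l y' s := by
  induction l generalizing y y' s with
  | zero =>
    rw [msgLen_zero, Nat.lt_one_iff] at hs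
    exact h s (by simp [hs, codeLen_zero])
  | succ l ih =>
    simp only [levelDecode]
    refine blockDecode_congr (fun a ha => ih (fun q hq => h _ ?_) (Nat.mod_lt _ (msgLen_pos l))) ?_
    · rw [codeLen_succ]
      calc a * codeLen l + q < (a + 1) * codeLen l := by rw [add_mul]; omega
        _ ≤ _ := Nat.mul_le_mul_right _ ha
    · rw [msgLen_succ] at hs
      exact Nat.div_lt_of_lt_mul (by rwa [mul_comm])

/-! ## Levels of nodes -/

theorem lt_tProd (l : ℕ) : l < tProd l := l.lt_two_pow_self.trans_le (two_pow_le_tProd l)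

theorem tProd_level_dvd (j : ℕ) : tProd (level j) ∣ j :=
  Nat.findGreatest_spec (P := fun l => tProd l ∣ j) (Nat.zero_le j) (by simp [tProd_zero])

theorem le_level {j l : ℕ} (hj : 0 < j) (h : tProd l ∣ j) : l ≤ level j :=
  Nat.le_findGreatest ((lt_tProd l).le.trans (Nat.le_of_dvd hj h)) h

theorem level_eq {j l : ℕ} (hj : 0 < j) (h : tProd l ∣ j) (h' : ¬ tProd (l + 1) ∣ j) :
    level j = l := by
  refine le_antisymm (not_lt.1 fun hlt => h' ?_) (le_level hj h)
  exact (tProd_dvd hlt).trans (tProd_level_dvd j)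

theorem level_le_maxRelayLevel {m j : ℕ} (h1 : 1 ≤ j) (h2 : j < m) : level j ≤ maxRelayLevel m :=
  Finset.le_sup (f := level) (Finset.mem_Icc.2 ⟨h1, by omega⟩)

theorem level_le_endLevel {m j : ℕ} (k : ℕ) (h1 : 1 ≤ j) (h2 : j < m) :
    level j ≤ endLevel m k :=
  (level_le_maxRelayLevel h1 h2).trans (le_max_right _ _)

/-- Otherwise the node `T_l` would itself be a relay node, of level at least `l`. -/
theorem le_tProd_of_maxRelayLevel_lt {m l : ℕ} (h : maxRelayLevel m < l) : m ≤ tProd l := by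
  by_contra hlt
  have := level_le_maxRelayLevel (tProd_pos l) (not_le.1 hlt)
  have := le_level (tProd_pos l) dvd_rfl
  omega

/-! ## Propagation of blocks along the chain -/

section Chain

open Classical in
/-- Failure of the `q`-th level-`l` block on the way from node `j` over `T_l` hops, in terms of the
set `E` of wrong votes: too many of its sub-blocks fail on some part of the way. -/
def Fails (E : ℕ → ℕ → Prop) : ℕ → ℕ → ℕ → Prop
  | 0, j, q => E j q
  | l + 1, j, q => errorThreshold (bSeq (l + 1)) ≤
      ((Finset.range (numSub (l + 1))).filter fun a =>
        ∃ i < tSeq (l + 1), Fails E l (j + i * tProd l) (q * numSub (l + 1) + a)).card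

theorem relayStream_block {l q s : ℕ} (u : ℕ → Bool) (hs : s < codeLen l) :
    relayStream l u (q * codeLen l + s) =
      levelEncode l (levelDecode l fun s => u (q * codeLen l + s)) s := by
  have h1 : (q * codeLen l + s) / codeLen l = q := by
    rw [mul_comm, Nat.mul_add_div (codeLen_pos l), Nat.div_eq_of_lt hs, add_zero]
  have h2 : (q * codeLen l + s) % codeLen l = s := by
    rw [mul_comm, Nat.mul_add_mod, Nat.mod_eq_of_lt hs]
  simp only [relayStream, h1, h2]

theorem levelEncode_succ_block {l a s : ℕ} (x : ℕ → Bool) (hs : s < codeLen l) :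
    levelEncode (l + 1) x (a * codeLen l + s) =
      levelEncode l
        (fun s => blockEncode (bSeq (l + 1)) (fun j => x (j * msgLen l + s)) a) s := by
  have h1 : (a * codeLen l + s) / codeLen l = a := by
    rw [mul_comm, Nat.mul_add_div (codeLen_pos l), Nat.div_eq_of_lt hs, add_zero]
  have h2 : (a * codeLen l + s) % codeLen l = s := by
    rw [mul_comm, Nat.mul_add_mod, Nat.mod_eq_of_lt hs]
  simp only [levelEncode, h1, h2]

/-- In a chain of `m` hops where node `j` sends the stream `S j` of `N` bits, the next node
receives `U j`, and `E` is the set of wrong votes, level-`l` blocks that do not fail arrive. -/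
def SegmentDecodes (S U : ℕ → ℕ → Bool) (E : ℕ → ℕ → Prop) (m N l : ℕ) : Prop :=
  ∀ j q x, tProd l ∣ j → j < m → (q + 1) * codeLen l ≤ N →
    (∀ s < codeLen l, S j (q * codeLen l + s) = levelEncode l x s) → ¬ Fails E l j q →
    ∀ s < msgLen l,
      levelDecode l (fun s => U (min (j + tProd l) m - 1) (q * codeLen l + s)) s = x s

variable {S U : ℕ → ℕ → Bool} {E : ℕ → ℕ → Prop} {m N : ℕ}

/-- At each joint a level-`l` node re-encodes a correctly decoded block, so the next segment again
starts from an exact codeword. The minimum with `m` cuts off the last segment; beyond `m` nothing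
changes any more. -/
theorem SegmentDecodes.chain {l : ℕ} (hdec : SegmentDecodes S U E m N l)
    (hS : ∀ j, j + 1 < m → ∀ q < N, S (j + 1) q = relayStream (level (j + 1)) (U j) q)
    {j q : ℕ} {x : ℕ → Bool} (hj : tProd l ∣ j) (hjm : j < m) (hq : (q + 1) * codeLen l ≤ N)
    (hx : ∀ s < codeLen l, S j (q * codeLen l + s) = levelEncode l x s) (t : ℕ)
    (hlev : ∀ i, 0 < i → i < t + 1 → j + i * tProd l < m → level (j + i * tProd l) = l)
    (hF : ∀ i < t + 1, ¬ Fails E l (j + i * tProd l) q) :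
    ∀ s < msgLen l, levelDecode l
      (fun s => U (min (j + (t + 1) * tProd l) m - 1) (q * codeLen l + s)) s = x s := by
  induction t with
  | zero => simpa using hdec j q x hj hjm hq hx (by simpa using hF 0 (by omega))
  | succ t ih =>
    have ih' := ih (fun i h0 h1 => hlev i h0 (by omega)) fun i hi => hF i (by omega)
    by_cases he : j + (t + 1) * tProd l < m
    · rw [min_eq_left he.le] at ih'
      have hpos : 0 < j + (t + 1) * tProd l := by
        have : 0 < (t + 1) * tProd l := Nat.mul_pos t.succ_pos (tProd_pos l)
        omega
      obtain ⟨e, hee⟩ := Nat.exists_eq_succ_of_ne_zero hpos.ne'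
      have hl := hlev (t + 1) (by omega) (by omega) he
      have key := hdec (j + (t + 1) * tProd l) q x (hj.add (dvd_mul_left _ _)) he hq
        (fun s hs => ?_) (hF (t + 1) (by omega))
      · rwa [add_assoc, ← Nat.succ_mul] at key
      · rw [hee] at ih' he hl ⊢
        have hlt : q * codeLen l + s < N := by rw [Nat.succ_mul] at hq; omega
        rw [hS e he _ hlt, hl, relayStream_block _ hs]
        exact levelEncode_congr ih' hs
    · have h1 : m ≤ j + (t + 1 + 1) * tProd l := by rw [Nat.succ_mul (t + 1)]; omega
      rw [min_eq_right (by omega)] at ih'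
      rwa [min_eq_right h1]

/-- Induction on the level: `chain` carries every sub-block without a failure through all `t_{l+1}`
segments, and the block code makes up for the rest. What happens to a failed sub-block afterwards is
irrelevant. -/
theorem segmentDecodes
    (hU : ∀ j < m, ∀ q < N, ¬ E j q → U j q = S j q)
    (hS : ∀ j, j + 1 < m → ∀ q < N, S (j + 1) q = relayStream (level (j + 1)) (U j) q) (l : ℕ) :
    SegmentDecodes S U E m N l := by
  induction l with
  | zero =>
    intro j q x _ hjm hq hx hF s hs
    rw [msgLen_zero, Nat.lt_one_iff] at hs
    subst hs
    have h0 := hx 0 (codeLen_pos 0)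
    simp only [codeLen_zero, mul_one, tProd_zero, levelDecode, levelEncode, add_zero] at *
    rw [min_eq_left (by omega), Nat.add_sub_cancel, hU j hjm q (by omega) hF, h0]
  | succ l ih =>
    classical
    intro j q x hj hjm hq hx hF s hs
    simp only [Fails, not_le] at hF
    set B := numSub (l + 1) with hB
    obtain ⟨t, ht⟩ := Nat.exists_eq_succ_of_ne_zero
      (show tSeq (l + 1) ≠ 0 by have := tSeq_ge l; omega)
    have hsub : ∀ a < B, ¬ (∃ i < tSeq (l + 1), Fails E l (j + i * tProd l) (q * B + a)) →
        ∀ s < msgLen l, levelDecode l (fun s => U (min (j + tProd (l + 1)) m - 1)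
          ((q * B + a) * codeLen l + s)) s =
            blockEncode (bSeq (l + 1)) (fun j => x (j * msgLen l + s)) a := by
      intro a ha hG
      push Not at hG
      rw [ht] at hG
      rw [tProd_succ, ht]
      refine ih.chain hS ((tProd_dvd l.le_succ).trans hj) hjm ?_ (fun s hs => ?_) t ?_ hG
      · refine le_trans ?_ hq
        rw [codeLen_succ, ← hB, ← mul_assoc]
        refine Nat.mul_le_mul_right _ ?_
        rw [Nat.succ_mul]
        omega
      · have := hx (a * codeLen l + s) ?_
        · rw [levelEncode_succ_block x hs] at this
          rw [← this, codeLen_succ, ← hB]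
          congr 1
          ring
        · rw [codeLen_succ]
          calc a * codeLen l + s < (a + 1) * codeLen l := by rw [Nat.succ_mul]; omega
            _ ≤ _ := Nat.mul_le_mul_right _ ha
      -- As `0 < i < t_{l+1}`, the node `j + i T_l` is not a multiple of `T_{l+1}`, so its level is
      -- exactly `l`.
      · intro i h0 hi _
        refine level_eq (by have := Nat.mul_pos h0 (tProd_pos l); omega)
          (((tProd_dvd l.le_succ).trans hj).add (dvd_mul_left _ _)) fun hd => ?_
        have h1 := (Nat.dvd_add_right hj).1 hd
        rw [tProd_succ] at h1
        have h2 := Nat.dvd_of_mul_dvd_mul_right (tProd_pos l) h1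
        have h3 := Nat.le_of_dvd h0 h2
        omega
    simp only [levelDecode]
    have hdiv : s / msgLen l < bSeq (l + 1) := by
      rw [msgLen_succ] at hs
      exact Nat.div_lt_of_lt_mul (by rwa [mul_comm])
    have key := blockDecode_of_card_lt (b := bSeq (l + 1)) (j := s / msgLen l)
      (fun i => x (i * msgLen l + s % msgLen l))
      (fun a => levelDecode l (fun s => U (min (j + tProd (l + 1)) m - 1)
          (q * codeLen (l + 1) + (a * codeLen l + s))) (s % msgLen l))
      (fun a => ∃ i < tSeq (l + 1), Fails E l (j + i * tProd l) (q * B + a))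
      (fun a ha hG => ?_) hF hdiv
    · rw [key, Nat.div_add_mod']
    · rw [← hsub a ha hG _ (Nat.mod_lt _ (msgLen_pos l)), codeLen_succ, ← hB]
      simp only [add_mul, mul_assoc, add_assoc]

/-- If all relay nodes have level at most `D`, then a level-`D` block that fails nowhere is decoded
correctly by the last node. -/
theorem decode_last
    (hU : ∀ j < m, ∀ q < N, ¬ E j q → U j q = S j q)
    (hS : ∀ j, j + 1 < m → ∀ q < N, S (j + 1) q = relayStream (level (j + 1)) (U j) q)
    {D q : ℕ} {x : ℕ → Bool} (hm : 0 < m) (hD : ∀ j, 1 ≤ j → j < m → level j ≤ D)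
    (hmT : m ≤ tProd (D + 1)) (hq : (q + 1) * codeLen D ≤ N)
    (hx : ∀ s < codeLen D, S 0 (q * codeLen D + s) = levelEncode D x s)
    (hF : ∀ i < tSeq (D + 1), ¬ Fails E D (i * tProd D) q) :
    ∀ s < msgLen D, levelDecode D (fun s => U (m - 1) (q * codeLen D + s)) s = x s := by
  obtain ⟨t, ht⟩ := Nat.exists_eq_succ_of_ne_zero
    (show tSeq (D + 1) ≠ 0 by have := tSeq_ge D; omega)
  rw [ht] at hF
  have key := (segmentDecodes hU hS D).chain hS (dvd_zero _) hm hq hx t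
    (fun i h0 _ him => ?_) (by simpa using hF)
  -- The `t_{D+1}` segments reach node `m` or beyond, so the minimum is `m`.
  · rw [tProd_succ, ht] at hmT
    rwa [zero_add, min_eq_right hmT] at key
  · have hpos : 0 < 0 + i * tProd D := by have := Nat.mul_pos h0 (tProd_pos D); omega
    exact le_antisymm (hD _ hpos him) (le_level hpos (by simp))

end Chain

/-! ## The streams of the protocol -/

/-- The vote on the bit at position `q` of the stream sent by node `j` is wrong (or a tie). -/
def VoteFails (r : ℕ) (z : ℕ → ℕ → Bool) (j q : ℕ) : Prop :=
  r ≤ 2 * ((Finset.range r).filter fun e => z j (startTime r j + r * q + e) = true).card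

theorem majority_congr {r : ℕ} {f g : ℕ → Bool} (h : ∀ e < r, f e = g e) :
    majority r f = majority r g := by
  unfold majority
  rw [Finset.filter_congr fun e he => by rw [h e (Finset.mem_range.1 he)]]

theorem majority_xor {r : ℕ} {f : ℕ → Bool} (b : Bool)
    (h : ¬ r ≤ 2 * ((Finset.range r).filter fun e => f e = true).card) :
    majority r (fun e => Bool.xor b (f e)) = b := by
  unfold majority
  cases b
  · simp only [Bool.false_xor, decide_eq_false_iff_not]
    omega
  · simp only [Bool.true_xor, Bool.not_eq_true', decide_eq_true_eq]
    have h1 := Finset.card_filter_add_card_filter_not (s := Finset.range r)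
      fun e => f e = true
    simp only [Bool.not_eq_true, Finset.card_range] at h1
    omega

theorem transmit_add {r N s q e : ℕ} (u : ℕ → Bool) (hq : q < N) (he : e < r) :
    transmit r N s u (s + r * q + e) = u q := by
  have h1 : r * q + e < r * N := by
    calc r * q + e < r * (q + 1) := by rw [mul_add]; omega
      _ ≤ _ := Nat.mul_le_mul_left _ hq
  have h2 : (s + r * q + e - s) / r = q := by
    rw [add_assoc, Nat.add_sub_cancel_left, Nat.mul_add_div (by omega), Nat.div_eq_of_lt he,
      add_zero]
  rw [transmit, if_pos ⟨by omega, by omega⟩, h2]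

/-- The stream of bits that node `j` sends, before repetition. -/
noncomputable def nodeStream (r m k : ℕ) (w : Fin k → Bool) (z : ℕ → ℕ → Bool) :
    ℕ → ℕ → Bool
  | 0 => sourceStream m k w
  | j + 1 => relayStream (level (j + 1)) fun q =>
      majority r fun e => Bool.xor (nodeStream r m k w z j q) (z j (startTime r j + r * q + e))

/-- The stream of votes of node `j + 1`. -/
noncomputable def voteStream (r m k : ℕ) (w : Fin k → Bool) (z : ℕ → ℕ → Bool) (j q : ℕ) : Bool :=
  majority r fun e => Bool.xor (nodeStream r m k w z j q) (z j (startTime r j + r * q + e))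

theorem relayStream_congr {l q : ℕ} {u u' : ℕ → Bool}
    (h : ∀ s < codeLen l, u (q / codeLen l * codeLen l + s) = u' (q / codeLen l * codeLen l + s)) :
    relayStream l u q = relayStream l u' q :=
  levelEncode_congr (fun _ hs => levelDecode_congr h hs) (Nat.mod_lt _ (codeLen_pos l))

theorem startTime_succ (r j : ℕ) :
    startTime r (j + 1) = startTime r j + r * codeLen (level (j + 1)) := by
  rw [startTime, Finset.sum_Icc_succ_top (by omega)]; rfl

theorem block_lt {n N q s : ℕ} (hn : n ∣ N) (hq : q < N) (hs : s < n) : q / n * n + s < N := by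
  obtain ⟨c, rfl⟩ := hn
  have h1 : q / n < c := Nat.div_lt_of_lt_mul hq
  calc q / n * n + s < (q / n + 1) * n := by rw [Nat.succ_mul]; omega
    _ ≤ c * n := Nat.mul_le_mul_right _ h1
    _ = n * c := mul_comm _ _

/-- This removes the timing: only the abstract bit streams matter afterwards. Block lengths of relay
nodes divide `streamLen m k`, so no block runs past the end of the stream. -/
theorem sent_eq_nodeStream {r m k : ℕ} (w : Fin k → Bool) (z : ℕ → ℕ → Bool)
    {j q e : ℕ} (hj : j < m) (hq : q < streamLen m k) (he : e < r) :
    (multiBit r m k).sent w z j (startTime r j + r * q + e) = nodeStream r m k w z j q := by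
  induction j generalizing q e with
  | zero =>
    have : startTime r 0 = 0 := by simp [startTime]
    rw [this]
    exact transmit_add _ hq he
  | succ j ih =>
    have hdvd : codeLen (level (j + 1)) ∣ streamLen m k :=
      (codeLen_dvd (level_le_endLevel k (by omega) hj)).mul_left _
    change transmit _ _ _ _ _ = _
    rw [transmit_add _ hq he, nodeStream]
    refine relayStream_congr fun s hs => ?_
    have hlt := block_lt hdvd hq hs
    set p := q / codeLen (level (j + 1)) * codeLen (level (j + 1)) + s with hp
    have hpq : p + 1 ≤ q + codeLen (level (j + 1)) := by
      have := Nat.div_mul_le_self q (codeLen (level (j + 1)))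
      omega
    refine majority_congr fun e' he' => ?_
    rw [Nat.add_sub_cancel]
    -- Causality: every bit of the block containing `q` lies less than `n_l` positions after `q`,
    -- and the node has waited for `r n_l` steps.
    have htime : startTime r j + r * p + e' < startTime r (j + 1) + r * q + e := by
      have h1 : r * p + r ≤ r * q + r * codeLen (level (j + 1)) := by
        rw [← Nat.mul_succ, ← mul_add]
        exact Nat.mul_le_mul_left r hpq
      rw [startTime_succ]
      omega
    beta_reduce
    rw [dif_pos htime]
    rw [ih (by omega) hlt he']

theorem decode_eq_of_not_fails {r m k : ℕ} (hm : 0 < m) (w : Fin k → Bool)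
    (z : ℕ → ℕ → Bool)
    (hF : ∀ q < numBlocks m k, ∀ i < tSeq (endLevel m k + 1),
      ¬ Fails (VoteFails r z) (endLevel m k) (i * tProd (endLevel m k)) q) :
    (multiBit r m k).estimate m w z = w := by
  funext x
  set D := endLevel m k with hD
  have hx : (x : ℕ) / msgLen D < numBlocks m k := by
    have h0 := msgLen_pos D
    rw [numBlocks, ← hD, Nat.div_lt_iff_lt_mul h0]
    have h1 := Nat.div_add_mod (k + msgLen D - 1) (msgLen D)
    have h2 := Nat.mod_lt (k + msgLen D - 1) h0
    rw [mul_comm] at h1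
    have := x.2
    omega
  have hblk : ((x : ℕ) / msgLen D + 1) * codeLen D ≤ streamLen m k :=
    Nat.mul_le_mul_right _ hx
  have key := decode_last (S := nodeStream r m k w z) (U := voteStream r m k w z)
    (E := VoteFails r z) (m := m) (N := streamLen m k) (D := D) (q := x / msgLen D)
    (x := fun s => if h : x / msgLen D * msgLen D + s < k then
      w ⟨x / msgLen D * msgLen D + s, h⟩ else false)
    (fun j _ q _ h => majority_xor _ h) (fun j _ q _ => rfl) hm
    (fun j h1 h2 => level_le_endLevel k h1 h2)
    (le_tProd_of_maxRelayLevel_lt (Nat.lt_succ_of_le (le_max_right _ _))) hblk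
    (fun s hs => ?_) (hF _ hx) (x % msgLen D) (Nat.mod_lt _ (msgLen_pos D))
  · have hxx : (x : ℕ) / msgLen D * msgLen D + x % msgLen D = x := Nat.div_add_mod' _ _
    simp only [hxx, Fin.is_lt, dite_true, Fin.eta] at key
    rw [← key]
    change levelDecode D _ _ = _
    refine levelDecode_congr (fun s hs => majority_congr fun e he => ?_)
      (Nat.mod_lt _ (msgLen_pos D))
    have hlt : (x : ℕ) / msgLen D * codeLen D + s < streamLen m k := by
      rw [Nat.succ_mul] at hblk; omega
    beta_reduce
    rw [dif_pos, Protocol.received, sent_eq_nodeStream w z (by omega) hlt he]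
    have h1 := Nat.mul_le_mul_left r (Nat.succ_le_of_lt hlt)
    rw [Nat.mul_succ] at h1
    rw [transmissionTime, ← hD]
    omega
  · have h1 : ((x : ℕ) / msgLen D * codeLen D + s) / codeLen D = x / msgLen D := by
      rw [mul_comm, Nat.mul_add_div (codeLen_pos D), Nat.div_eq_of_lt hs, add_zero]
    have h2 : ((x : ℕ) / msgLen D * codeLen D + s) % codeLen D = s := by
      rw [mul_comm, Nat.mul_add_mod, Nat.mod_eq_of_lt hs]
    simp only [nodeStream, sourceStream, ← hD, h1, h2]

open MeasureTheory ProbabilityTheory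

/-! ## Probabilities of failure -/

/-- Each event is the preimage, under restriction to its coordinates, of its own image. Finiteness
makes these images measurable, so independence of disjoint coordinate families applies. -/
theorem measureReal_dependsOn_and {ι : Type*} [Fintype ι] {β : Type*} [MeasurableSpace β]
    [MeasurableSingletonClass β] [Finite β] (μ : ι → Measure β)
    [∀ i, IsProbabilityMeasure (μ i)] {P Q : (ι → β) → Prop} {s t : Set ι}
    (hP : DependsOn P s) (hQ : DependsOn Q t) (hst : Disjoint s t) :
    (Measure.pi μ).real {z | P z ∧ Q z} =
      (Measure.pi μ).real {z | P z} * (Measure.pi μ).real {z | Q z} := by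
  classical
  have hind : iIndepFun (fun i (ω : ι → β) => ω i) (Measure.pi μ) :=
    iIndepFun_pi (X := fun _ => id) fun i => aemeasurable_id
  have h2 := hind.indepFun_finset s.toFinset t.toFinset (Set.disjoint_toFinset.2 hst)
    fun i => measurable_pi_apply i
  have fact : ∀ {P : (ι → β) → Prop} {s : Set ι}, DependsOn P s →
      ∃ A : Set (s.toFinset → β),
        {z | P z} = (fun (z : ι → β) (i : s.toFinset) => z i) ⁻¹' A := by
    intro P s hP
    refine ⟨(fun (z : ι → β) (i : s.toFinset) => z i) '' {z | P z}, ?_⟩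
    refine Set.Subset.antisymm (Set.subset_preimage_image _ _) ?_
    rintro z ⟨z', hz', he⟩
    have : P z' = P z := hP fun i hi => congrFun he ⟨i, Set.mem_toFinset.2 hi⟩
    exact cast this hz'
  obtain ⟨A, hA⟩ := fact hP
  obtain ⟨B, hB⟩ := fact hQ
  have h3 := h2.measure_inter_preimage_eq_mul A B (Set.toFinite A).measurableSet
    (Set.toFinite B).measurableSet
  rw [← hA, ← hB] at h3
  change (Measure.pi μ).real ({z | P z} ∩ {z | Q z}) = _
  rw [measureReal_def, h3, ENNReal.toReal_mul]
  rfl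

theorem measureReal_exists_lt_le {Ω : Type*} [MeasurableSpace Ω] (μ : Measure Ω)
    [IsFiniteMeasure μ] (B : ℕ) (c : ℝ) (P : ℕ → Ω → Prop)
    (h : ∀ a < B, μ.real {z | P a z} ≤ c) : μ.real {z | ∃ a < B, P a z} ≤ B * c := by
  have he : {z | ∃ a < B, P a z} = ⋃ a ∈ Finset.range B, {z | P a z} := by
    ext z; simp
  rw [he]
  refine (measureReal_biUnion_finset_le _ _).trans ?_
  refine (Finset.sum_le_card_nsmul _ _ c fun a ha => h a (Finset.mem_range.1 ha)).trans ?_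
  simp

instance (p : unitInterval) (m n : ℕ) : IsProbabilityMeasure (noiseLaw p m n) := by
  unfold noiseLaw; infer_instance

theorem Fails.exists_sub {E : ℕ → ℕ → Prop} {l j q : ℕ} (h : Fails E (l + 1) j q) :
    ∃ a < numSub (l + 1), ∃ i < tSeq (l + 1),
      Fails E l (j + i * tProd l) (q * numSub (l + 1) + a) := by
  classical
  have h1 : 1 ≤ errorThreshold (bSeq (l + 1)) := by unfold errorThreshold; split_ifs <;> omega
  obtain ⟨a, ha⟩ := Finset.card_pos.1 (h1.trans h)
  simp only [Finset.mem_filter, Finset.mem_range] at ha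
  exact ⟨a, ha⟩

theorem Fails.exists_two_sub {E : ℕ → ℕ → Prop} {l j q : ℕ} (hl : 1 ≤ l)
    (h : Fails E (l + 1) j q) :
    ∃ a < numSub (l + 1), ∃ a' < numSub (l + 1), a ≠ a' ∧
      (∃ i < tSeq (l + 1), Fails E l (j + i * tProd l) (q * numSub (l + 1) + a)) ∧
      ∃ i < tSeq (l + 1), Fails E l (j + i * tProd l) (q * numSub (l + 1) + a') := by
  classical
  have h1 : errorThreshold (bSeq (l + 1)) = 2 := by
    have := four_le_bSeq (show 2 ≤ l + 1 by omega)
    rw [errorThreshold, if_neg (by omega)]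
  have h2 : 1 < _ := (h1.symm.le.trans h : 2 ≤ _)
  obtain ⟨a, ha, a', ha', hne⟩ := Finset.one_lt_card.1 h2
  simp only [Finset.mem_filter, Finset.mem_range] at ha ha'
  exact ⟨a, ha.1, a', ha'.1, hne, ha.2, ha'.2⟩

/-- The channel uses for the `q`-th block of level `l`. -/
def blockUses (r m n l q : ℕ) : Set (Fin m × Fin n) :=
  {x | startTime r x.1 + r * (q * codeLen l) ≤ x.2 ∧
    (x.2 : ℕ) < startTime r x.1 + r * ((q + 1) * codeLen l)}

theorem blockUses_succ_subset {r m n l q a : ℕ} (ha : a < numSub (l + 1)) :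
    blockUses r m n l (q * numSub (l + 1) + a) ⊆ blockUses r m n (l + 1) q := by
  rintro x ⟨h1, h2⟩
  refine ⟨le_trans ?_ h1, h2.trans_le ?_⟩ <;>
    refine Nat.add_le_add_left (Nat.mul_le_mul_left r ?_) _ <;>
    rw [codeLen_succ, ← mul_assoc] <;>
    refine Nat.mul_le_mul_right _ ?_
  · exact Nat.le_add_right _ _
  · rw [Nat.succ_mul]
    omega

theorem disjoint_blockUses {r m n l q q' : ℕ} (h : q ≠ q') :
    Disjoint (blockUses r m n l q) (blockUses r m n l q') := by
  wlog hlt : q < q' generalizing q q'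
  · exact (this h.symm (by omega)).symm
  rw [Set.disjoint_left]
  rintro x ⟨_, h1⟩ ⟨h2, _⟩
  have : r * ((q + 1) * codeLen l) ≤ r * (q' * codeLen l) := by gcongr; omega
  omega

theorem dependsOn_fails (r m n l j q : ℕ) :
    DependsOn (fun z : Fin m × Fin n → Bool => Fails (VoteFails r (extendNoise z)) l j q)
      (blockUses r m n l q) := by
  induction l generalizing j q with
  | zero =>
    intro z z' h
    simp only [Fails, VoteFails]
    refine congrArg (fun s : Finset ℕ => r ≤ 2 * s.card) (Finset.filter_congr fun e he => ?_)
    rw [Finset.mem_range] at he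
    suffices extendNoise z j (startTime r j + r * q + e) =
      extendNoise z' j (startTime r j + r * q + e) by rw [this]
    unfold extendNoise
    split_ifs with hin
    · refine h _ ⟨?_, ?_⟩
      · simp only [codeLen_zero, mul_one]; omega
      · simp only [codeLen_zero, mul_one, mul_add]; omega
    · rfl
  | succ l ih =>
    intro z z' h
    simp only [Fails]
    refine congrArg (fun s : Finset ℕ => errorThreshold (bSeq (l + 1)) ≤ s.card)
      (Finset.ext fun a => ?_)
    simp only [Finset.mem_filter]
    refine and_congr_right fun ha => ?_
    refine exists_congr fun i => and_congr_right fun _ => Iff.of_eq (ih _ _ fun x hx => h x ?_)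
    exact blockUses_succ_subset (Finset.mem_range.1 ha) hx

/-- Used for the step from level 0 to level 1 only, where one bad sub-block is already fatal. -/
theorem measureReal_fails_succ_le_linear (p : unitInterval) {r m n l : ℕ} {δ : ℝ}
    (h : ∀ j q, (noiseLaw p m n).real {z | Fails (VoteFails r (extendNoise z)) l j q} ≤ δ)
    (j q : ℕ) :
    (noiseLaw p m n).real {z | Fails (VoteFails r (extendNoise z)) (l + 1) j q} ≤
      numSub (l + 1) * (tSeq (l + 1) * δ) := by
  refine (measureReal_mono fun z hz => Fails.exists_sub hz).trans ?_
  exact measureReal_exists_lt_le _ _ _ _ fun a _ =>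
    measureReal_exists_lt_le _ _ _ _ fun i _ => h _ _

/-- Two distinct sub-blocks must fail, possibly on different segments. Their channel uses are
disjoint over the entire chain, so the probabilities multiply; the union bound runs over pairs of
sub-blocks and of segments. -/
theorem measureReal_fails_succ_le_sq (p : unitInterval) {r m n l : ℕ} {δ : ℝ} (hl : 1 ≤ l)
    (h : ∀ j q, (noiseLaw p m n).real {z | Fails (VoteFails r (extendNoise z)) l j q} ≤ δ)
    (j q : ℕ) :
    (noiseLaw p m n).real {z | Fails (VoteFails r (extendNoise z)) (l + 1) j q} ≤
      (numSub (l + 1) * tSeq (l + 1)) ^ 2 * δ ^ 2 := by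
  refine (measureReal_mono fun z hz => Fails.exists_two_sub hl hz).trans ?_
  have hsub : ∀ a, (noiseLaw p m n).real {z | ∃ i < tSeq (l + 1),
      Fails (VoteFails r (extendNoise z)) l (j + i * tProd l) (q * numSub (l + 1) + a)} ≤
        tSeq (l + 1) * δ :=
    fun a => measureReal_exists_lt_le _ _ _ _ fun i _ => h _ _
  have hdep : ∀ a, DependsOn (fun z : Fin m × Fin n → Bool => ∃ i < tSeq (l + 1),
      Fails (VoteFails r (extendNoise z)) l (j + i * tProd l) (q * numSub (l + 1) + a))
      (blockUses r m n l (q * numSub (l + 1) + a)) := by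
    intro a z z' hz
    simp only [eq_iff_iff]
    exact exists_congr fun i => and_congr_right fun _ =>
      Iff.of_eq (dependsOn_fails r m n l _ _ hz)
  have hpos : 0 ≤ tSeq (l + 1) * δ := measureReal_nonneg.trans (hsub 0)
  have key : ∀ a < numSub (l + 1), (noiseLaw p m n).real {z | ∃ a' < numSub (l + 1), a ≠ a' ∧
      (∃ i < tSeq (l + 1),
        Fails (VoteFails r (extendNoise z)) l (j + i * tProd l) (q * numSub (l + 1) + a)) ∧
      ∃ i < tSeq (l + 1),
        Fails (VoteFails r (extendNoise z)) l (j + i * tProd l) (q * numSub (l + 1) + a')} ≤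
      numSub (l + 1) * (tSeq (l + 1) * δ) ^ 2 := by
    intro a _
    refine measureReal_exists_lt_le _ _ _ _ fun a' _ => ?_
    by_cases hne : a = a'
    · simp only [hne, ne_eq, not_true_eq_false, false_and, Set.ofPred_false, measureReal_empty]
      positivity
    · simp only [ne_eq, hne, not_false_eq_true, true_and]
      rw [noiseLaw, measureReal_dependsOn_and _ (hdep a) (hdep a')
        (disjoint_blockUses (by omega)), sq]
      exact mul_le_mul (hsub a) (hsub a') measureReal_nonneg hpos
  refine (measureReal_exists_lt_le _ _ _ _ key).trans (le_of_eq ?_)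
  ring

/-- A vote over `r` repetitions fails with exponentially small probability. -/
theorem measureReal_voteFails_le (p : unitInterval) (hp0 : 0 < (p : ℝ)) (hp : (p : ℝ) < 1 / 2)
    (r m n j q : ℕ) :
    (noiseLaw p m n).real {z | VoteFails r (extendNoise z) j q} ≤
      (1 / 2 + 2 * p * (1 - p)) ^ r := by
  classical
  -- Chernoff bound: each flip gets weight `σ ^ 2`, and a failed vote has at least `r / 2` flips.
  -- This `σ` is not optimal but gives the rational base `p σ + (1 - p) / σ = 1/2 + 2p(1 - p)`.
  set σ : ℝ := 1 / (2 * p) with hσ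
  have hσ1 : 1 ≤ σ := by rw [hσ, le_div_iff₀ (by linarith)]; linarith
  set A : Finset (Fin m × Fin n) := Finset.univ.filter fun x =>
    (x.1 : ℕ) = j ∧ startTime r j + r * q ≤ x.2 ∧ (x.2 : ℕ) < startTime r j + r * q + r with hA
  -- Only an inequality: some of the `r` channel uses may lie outside the range, where `extendNoise`
  -- is `false`.
  have hAr : A.card ≤ r := by
    have h := Finset.card_le_card_of_injOn (s := A) (t := Finset.range r)
      (fun x => (x.2 : ℕ) - (startTime r j + r * q)) (fun x hx => ?_) (fun x hx y hy hxy => ?_)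
    · simpa using h
    · simp only [hA, Finset.coe_filter, Finset.mem_univ, true_and, Set.mem_ofPred_eq] at hx
      simp only [Finset.coe_range, Set.mem_Iio]
      omega
    · simp only [hA, Finset.coe_filter, Finset.mem_univ, true_and, Set.mem_ofPred_eq] at hx hy
      simp only at hxy
      exact Prod.ext (Fin.ext (by omega)) (Fin.ext (by omega))
  set f : (Fin m × Fin n) → Bool → ℝ := fun x b => if x ∈ A ∧ b = true then σ ^ 2 else 1 with hf
  have hf1 : ∀ x b, 1 ≤ f x b := fun x b => by
    simp only [hf]; split_ifs
    · exact one_le_pow₀ hσ1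
    · exact le_rfl
  have hint : ∫ z, ∏ x, f x (z x) ∂(noiseLaw p m n) ≤ (p * σ ^ 2 + (1 - p)) ^ r := by
    rw [noiseLaw, integral_fintype_prod_eq_prod]
    simp only [integral_bernoulliMeasure]
    calc ∏ x, ((p : ℝ) • f x true + (1 - p : ℝ) • f x false)
        = ∏ x, if x ∈ A then p * σ ^ 2 + (1 - p : ℝ) else 1 := by
          refine Finset.prod_congr rfl fun x _ => ?_
          by_cases hx : x ∈ A <;> simp [hf, hx]
      _ = (p * σ ^ 2 + (1 - p : ℝ)) ^ A.card := by
          rw [Finset.prod_ite_mem, Finset.univ_inter, Finset.prod_const]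
      _ ≤ _ := by
          refine pow_le_pow_right₀ ?_ hAr
          have : 1 ≤ σ ^ 2 := one_le_pow₀ hσ1
          nlinarith
  have hev : ∀ z, VoteFails r (extendNoise z) j q → σ ^ r ≤ ∏ x, f x (z x) := by
    intro z hz
    set V := A.filter fun x => z x = true with hV
    have hprod : ∏ x, f x (z x) = (σ ^ 2) ^ V.card := by
      have : ∀ x, f x (z x) = if x ∈ V then σ ^ 2 else 1 := fun x => by
        simp only [hf, hV, Finset.mem_filter]
      simp only [this]
      rw [Finset.prod_ite_mem, Finset.univ_inter, Finset.prod_const]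
    have hcard : ((Finset.range r).filter fun e =>
        extendNoise z j (startTime r j + r * q + e) = true).card ≤ V.card := by
      refine (Finset.card_le_card (t := V.image fun x => (x.2 : ℕ) - (startTime r j + r * q))
        fun e he => ?_).trans Finset.card_image_le
      rw [Finset.mem_filter, Finset.mem_range] at he
      obtain ⟨her, he⟩ := he
      unfold extendNoise at he
      split_ifs at he with hin
      refine Finset.mem_image.2 ⟨(⟨j, hin.1⟩, ⟨_, hin.2⟩), ?_, ?_⟩
      · simp only [hV, hA, Finset.mem_filter, Finset.mem_univ, true_and, he, and_true]
        omega
      · simp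
    rw [hprod, ← pow_mul]
    exact pow_le_pow_right₀ hσ1 (hz.trans (by gcongr))
  have hmark := mul_meas_ge_le_integral_of_nonneg (μ := noiseLaw p m n)
    (f := fun z => ∏ x, f x (z x))
    (ae_of_all _ fun z => Finset.prod_nonneg fun x _ => zero_le_one.trans (hf1 _ _))
    Integrable.of_finite (σ ^ r)
  have hσ0 : 0 < σ ^ r := by positivity
  have hle : (noiseLaw p m n).real {z | VoteFails r (extendNoise z) j q} ≤
      (noiseLaw p m n).real {z | σ ^ r ≤ ∏ x, f x (z x)} := measureReal_mono fun z hz => hev z hz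
  have hfin : σ ^ r * (noiseLaw p m n).real {z | VoteFails r (extendNoise z) j q} ≤
      (p * σ ^ 2 + (1 - p)) ^ r :=
    (mul_le_mul_of_nonneg_left hle hσ0.le).trans (hmark.trans hint)
  have heq : (p * σ ^ 2 + (1 - p) : ℝ) = σ * (1 / 2 + 2 * p * (1 - p)) := by
    rw [hσ]; field_simp
  rw [heq, mul_pow] at hfin
  exact le_of_mul_le_mul_left hfin hσ0

/-- The bound on the probability that a block of level `l` fails. -/
noncomputable def failBound (l : ℕ) : ℝ := Real.exp (-2 ^ l) / (256 * (l + 3) ^ 8)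

theorem numSub_mul_tSeq_le (l : ℕ) : (numSub (l + 1) * tSeq (l + 1) : ℝ) ≤ (l + 3) ^ 4 := by
  have h1 : (numSub (l + 1) : ℝ) ≤ tSeq (l + 1) := by
    exact_mod_cast (by have := two_mul_numSub_le l; omega : numSub (l + 1) ≤ tSeq (l + 1))
  have h2 : (tSeq (l + 1) : ℝ) = (l + 3) ^ 2 := by simp only [tSeq]; push_cast; ring
  calc (numSub (l + 1) * tSeq (l + 1) : ℝ) ≤ tSeq (l + 1) * tSeq (l + 1) := by gcongr
    _ = _ := by rw [h2]; ring

/-- One factor `(l+3)^8` of `failBound l ^ 2` cancels the number of pairs; one factor `256 = 2^8`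
absorbs the passage from `l + 3` to `l + 4`. -/
theorem failBound_step (l : ℕ) : ((l + 3 : ℝ) ^ 4) ^ 2 * failBound l ^ 2 ≤ failBound (l + 1) := by
  have h1 : (((l + 1 : ℕ) : ℝ) + 3) ^ 8 ≤ 256 * (l + 3) ^ 8 := by
    calc (((l + 1 : ℕ) : ℝ) + 3) ^ 8 ≤ (2 * (l + 3)) ^ 8 := by
          gcongr; push_cast; linarith [(Nat.cast_nonneg l : (0 : ℝ) ≤ l)]
      _ = _ := by ring
  have h2 : Real.exp (-2 ^ (l + 1)) = Real.exp (-2 ^ l) ^ 2 := by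
    rw [← Real.exp_nat_mul]; congr 1; push_cast; ring
  have h3 : ((l + 3 : ℝ) ^ 4) ^ 2 * failBound l ^ 2 =
      Real.exp (-2 ^ l) ^ 2 / (256 * (256 * (l + 3) ^ 8)) := by
    unfold failBound; field_simp
  rw [h3, failBound, h2]
  gcongr

theorem measureReal_fails_le (p : unitInterval) {r m n : ℕ} {δ : ℝ}
    (h : ∀ j q, (noiseLaw p m n).real {z | VoteFails r (extendNoise z) j q} ≤ δ)
    (hδ : 256 * δ ≤ failBound 1) (l j q : ℕ) (hl : 1 ≤ l) :
    (noiseLaw p m n).real {z | Fails (VoteFails r (extendNoise z)) l j q} ≤ failBound l := by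
  have hδ0 : 0 ≤ δ := measureReal_nonneg.trans (h 0 0)
  induction l, hl using Nat.le_induction generalizing j q with
  | base =>
    refine (measureReal_fails_succ_le_linear p (l := 0) h j q).trans ?_
    -- The union bound at level 1 has at most `3^4 = 81 ≤ 256` terms.
    have := numSub_mul_tSeq_le 0
    norm_num at this
    rw [← mul_assoc]
    norm_num
    nlinarith
  | succ l hl ih =>
    refine (measureReal_fails_succ_le_sq p hl ih j q).trans (le_trans ?_ (failBound_step l))
    gcongr
    exact numSub_mul_tSeq_le l

theorem errorProb_le (p : unitInterval) {r m k : ℕ} {δ : ℝ} (hm : 0 < m)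
    (h : ∀ j q, (noiseLaw p m (transmissionTime r m k)).real
      {z | VoteFails r (extendNoise z) j q} ≤ δ)
    (hδ : 256 * δ ≤ failBound 1) (hD : 1 ≤ endLevel m k) (w : Fin k → Bool) :
    (multiBit r m k).errorProb p m w ≤
      numBlocks m k * (tSeq (endLevel m k + 1) * failBound (endLevel m k)) := by
  rw [Protocol.errorProb]
  refine (measureReal_mono (s₂ := {z | ∃ q < numBlocks m k, ∃ i < tSeq (endLevel m k + 1),
    Fails (VoteFails r (extendNoise z)) (endLevel m k) (i * tProd (endLevel m k)) q})
    fun z hz => ?_).trans ?_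
  · by_contra hc
    simp only [Set.mem_ofPred_eq] at hc hz
    push Not at hc
    exact hz (decode_eq_of_not_fails hm w _ hc)
  · exact measureReal_exists_lt_le _ _ _ _ fun a _ =>
      measureReal_exists_lt_le _ _ _ _ fun i _ => measureReal_fails_le p h hδ _ _ _ hD

/-! ## Rates and lengths -/

theorem codeLen_mul_two_pow_le (l : ℕ) : codeLen l * 2 ^ l ≤ tProd l := by
  induction l with
  | zero => simp [codeLen_zero, tProd_zero]
  | succ l ih =>
    rw [codeLen_succ, tProd_succ, pow_succ]
    calc numSub (l + 1) * codeLen l * (2 ^ l * 2) = 2 * numSub (l + 1) * (codeLen l * 2 ^ l) := by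
          ring
      _ ≤ _ := Nat.mul_le_mul (two_mul_numSub_le l) ih

theorem sum_codeLen_level_le (m : ℕ) :
    (∑ j ∈ Finset.Icc 1 m, codeLen (level j) : ℝ) ≤ 2 * m := by
  -- Charging `j` for every `l` with `T_l ∣ j`, and not just the largest, makes the exchange of sums
  -- easy and still leaves a geometric series.
  have h1 : ∀ j ∈ Finset.Icc 1 m, (codeLen (level j) : ℝ) ≤
      ∑ l ∈ Finset.range (m + 1), if tProd l ∣ j then (codeLen l : ℝ) else 0 := by
    intro j hj
    rw [Finset.mem_Icc] at hj
    refine le_trans ?_ (Finset.single_le_sum (s := Finset.range (m + 1))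
      (f := fun l => if tProd l ∣ j then (codeLen l : ℝ) else 0) (a := level j)
      (fun i _ => by positivity) ?_)
    · simp [tProd_level_dvd]
    · have := Nat.findGreatest_le (P := fun l => tProd l ∣ j) j
      rw [Finset.mem_range]
      exact Nat.lt_succ_of_le (this.trans hj.2)
  refine (Finset.sum_le_sum h1).trans ?_
  rw [Finset.sum_comm]
  have h2 : ∀ l ∈ Finset.range (m + 1),
      (∑ j ∈ Finset.Icc 1 m, if tProd l ∣ j then (codeLen l : ℝ) else 0) ≤ m * (1 / 2) ^ l := by
    intro l _
    rw [← Finset.sum_filter, Finset.sum_const, nsmul_eq_mul]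
    have hc : ((Finset.Icc 1 m).filter fun j => tProd l ∣ j).card = m / tProd l :=
      Nat.Ioc_filter_dvd_card_eq_div m (tProd l)
    rw [hc]
    have hT : (0 : ℝ) < tProd l := by exact_mod_cast tProd_pos l
    have h3 : ((m / tProd l : ℕ) : ℝ) ≤ m / tProd l := Nat.cast_div_le
    have h4 : (codeLen l * 2 ^ l : ℝ) ≤ tProd l := by exact_mod_cast codeLen_mul_two_pow_le l
    calc ((m / tProd l : ℕ) : ℝ) * codeLen l ≤ m / tProd l * codeLen l := by gcongr
      _ = m * (codeLen l / tProd l) := by ring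
      _ ≤ m * (1 / 2) ^ l := by
        gcongr
        rw [div_pow, one_pow, div_le_div_iff₀ hT (by positivity), one_mul]
        exact h4
  refine (Finset.sum_le_sum h2).trans ?_
  rw [← Finset.mul_sum, mul_comm]
  gcongr
  have := Summable.sum_le_tsum (Finset.range (m + 1)) (fun l _ => by positivity)
    (summable_geometric_of_lt_one (r := (1 / 2 : ℝ)) (by norm_num) (by norm_num))
  rw [tsum_geometric_of_lt_one (by norm_num) (by norm_num)] at this
  norm_num at this ⊢
  exact this

theorem startTime_le (r m : ℕ) : (startTime r m : ℝ) ≤ r * (2 * m) := by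
  rw [startTime, ← Finset.mul_sum]
  push_cast
  gcongr
  exact sum_codeLen_level_le m

theorem le_startTime {r : ℕ} (hr : 0 < r) (m : ℕ) : m ≤ startTime r m := by
  rw [startTime]
  calc m = ∑ j ∈ Finset.Icc 1 m, 1 := by simp
    _ ≤ _ := Finset.sum_le_sum fun j _ => Nat.mul_pos hr (codeLen_pos _)

/-- The redundancy is logarithmic in `b`, hence at most `10 y^{1/2}`, while `b ≥ y^2 / 8`, with `y =
i + 3`. The exponent matters only in being less than `-1`, for summability. -/
theorem redundancy_bSeq_div_le (i : ℕ) :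
    (redundancy (bSeq (i + 1)) / bSeq (i + 1) : ℝ) ≤ 80 * ((i + 3 : ℕ) : ℝ) ^ (-(3 / 2) : ℝ) := by
  set y : ℝ := ((i + 3 : ℕ) : ℝ) with hy
  have hy1 : 1 ≤ y := by rw [hy]; push_cast; linarith [(Nat.cast_nonneg i : (0 : ℝ) ≤ i)]
  have hy0 : 0 < y := by linarith
  have hb2 := two_le_bSeq i
  have hb0 : (0 : ℝ) < bSeq (i + 1) := by exact_mod_cast (by omega : 0 < bSeq (i + 1))
  have hlow : y ^ 2 / 8 ≤ bSeq (i + 1) := by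
    have : (i + 3) ^ 2 ≤ 8 * bSeq (i + 1) := by
      have h := Nat.div_add_mod ((i + 1 + 2) ^ 2) 4
      have h' := Nat.mod_lt ((i + 1 + 2) ^ 2) (show 0 < 4 by norm_num)
      have : bSeq (i + 1) = (i + 1 + 2) ^ 2 / 4 := rfl
      rw [← this] at h
      rw [show i + 3 = i + 1 + 2 from rfl]
      omega
    have h : (y : ℝ) ^ 2 ≤ 8 * bSeq (i + 1) := by rw [hy]; exact_mod_cast this
    linarith
  have hup : (bSeq (i + 1) : ℝ) ≤ y ^ (2 : ℝ) := by
    have : bSeq (i + 1) ≤ (i + 3) ^ 2 := Nat.div_le_self _ _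
    rw [Real.rpow_two, hy]
    exact_mod_cast this
  have hlog : Real.log (bSeq (i + 1)) ≤ 4 * y ^ (1 / 2 : ℝ) := by
    have h := Real.log_le_rpow_div hb0.le (show (0 : ℝ) < 1 / 4 by norm_num)
    have h2 : (bSeq (i + 1) : ℝ) ^ (1 / 4 : ℝ) ≤ y ^ (1 / 2 : ℝ) := by
      calc (bSeq (i + 1) : ℝ) ^ (1 / 4 : ℝ) ≤ (y ^ (2 : ℝ)) ^ (1 / 4 : ℝ) := by gcongr
        _ = _ := by rw [← Real.rpow_mul hy0.le]; norm_num
    linarith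
  have hsq : 1 ≤ y ^ (1 / 2 : ℝ) := Real.one_le_rpow hy1 (by norm_num)
  have hred : (redundancy (bSeq (i + 1)) : ℝ) ≤ 10 * y ^ (1 / 2 : ℝ) := by
    have hlb0 : 0 ≤ Real.logb 2 (bSeq (i + 1)) :=
      Real.logb_nonneg (by norm_num) (by exact_mod_cast (by omega : 1 ≤ bSeq (i + 1)))
    have h1 := (Nat.ceil_lt_add_one hlb0).le
    have h2 : ⌈Real.logb 2 (bSeq (i + 1))⌉₊ = Nat.clog 2 (bSeq (i + 1)) :=
      mod_cast Real.natCeil_logb_natCast 2 (bSeq (i + 1))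
    rw [h2] at h1
    have h3 : Real.logb 2 (bSeq (i + 1)) ≤ 2 * Real.log (bSeq (i + 1)) := by
      have hl2 := Real.log_two_gt_d9
      have hl : 0 ≤ Real.log (bSeq (i + 1)) := Real.log_natCast_nonneg _
      rw [Real.logb, div_le_iff₀ (by linarith)]
      nlinarith
    have h4 : (redundancy (bSeq (i + 1)) : ℝ) = Nat.clog 2 (bSeq (i + 1)) + 1 := by
      simp [redundancy]
    rw [h4]
    linarith
  calc (redundancy (bSeq (i + 1)) / bSeq (i + 1) : ℝ) ≤ 10 * y ^ (1 / 2 : ℝ) / (y ^ 2 / 8) := by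
        gcongr
    _ = 80 * (y ^ (1 / 2 : ℝ) / y ^ (2 : ℝ)) := by rw [Real.rpow_two]; field_simp; norm_num
    _ = _ := by rw [← Real.rpow_sub hy0]; norm_num

/-- The product of the factors `1 + redundancy / b` is at most the exponential of a convergent sum.
-/
theorem exists_codeLen_le : ∃ R : ℝ, 0 < R ∧ ∀ l, (codeLen l : ℝ) ≤ R * msgLen l := by
  have hs : Summable fun i : ℕ => 80 * ((i + 3 : ℕ) : ℝ) ^ (-(3 / 2) : ℝ) :=
    ((summable_nat_add_iff (f := fun i : ℕ => ((i : ℕ) : ℝ) ^ (-(3 / 2) : ℝ)) 3).2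
      (Real.summable_nat_rpow.2 (by norm_num))).mul_left _
  refine ⟨Real.exp (∑' i : ℕ, 80 * ((i + 3 : ℕ) : ℝ) ^ (-(3 / 2) : ℝ)), Real.exp_pos _,
    fun l => ?_⟩
  have key : (codeLen l : ℝ) ≤
      Real.exp (∑ i ∈ Finset.range l, 80 * ((i + 3 : ℕ) : ℝ) ^ (-(3 / 2) : ℝ)) * msgLen l := by
    induction l with
    | zero => simp [codeLen_zero, msgLen_zero]
    | succ l ih =>
      have hb0 : (0 : ℝ) < bSeq (l + 1) := by
        exact_mod_cast (by have := two_le_bSeq l; omega : 0 < bSeq (l + 1))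
      have hstep : (numSub (l + 1) : ℝ) ≤
          Real.exp (80 * ((l + 3 : ℕ) : ℝ) ^ (-(3 / 2) : ℝ)) * bSeq (l + 1) := by
        have h1 := Real.add_one_le_exp (80 * ((l + 3 : ℕ) : ℝ) ^ (-(3 / 2) : ℝ))
        have h2 := redundancy_bSeq_div_le l
        have h3 : (numSub (l + 1) : ℝ) =
            (redundancy (bSeq (l + 1)) / bSeq (l + 1) + 1) * bSeq (l + 1) := by
          rw [numSub, add_mul, div_mul_cancel₀ _ hb0.ne']
          push_cast
          ring
        rw [h3]
        gcongr
        linarith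
      rw [codeLen_succ, msgLen_succ, Finset.sum_range_succ, Real.exp_add]
      push_cast
      calc (numSub (l + 1) * codeLen l : ℝ) ≤ _ := mul_le_mul hstep ih (by positivity) (by positivity)
        _ = _ := by push_cast; ring
  refine key.trans ?_
  gcongr
  exact hs.sum_le_tsum _ fun i _ => by positivity

theorem tProd_maxRelayLevel_le {m : ℕ} (hm : 1 ≤ m) : tProd (maxRelayLevel m) ≤ m := by
  refine Finset.sup_induction (p := fun l => tProd l ≤ m) ?_ (fun a ha b hb => ?_) fun j hj => ?_
  · change tProd 0 ≤ m
    rwa [tProd_zero]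
  · rcases max_choice a b with h | h
    · change tProd (max a b) ≤ m; rwa [h]
    · change tProd (max a b) ≤ m; rwa [h]
  · rw [Finset.mem_Icc] at hj
    exact (Nat.le_of_dvd hj.1 (tProd_level_dvd j)).trans (by omega)

theorem lt_msgLen_msgLevel_succ (k : ℕ) : k < msgLen (msgLevel k + 1) := by
  by_contra h
  have h1 : msgLevel k + 1 ≤ k :=
    ((Nat.lt_two_pow_self).le.trans (two_pow_le_msgLen _)).trans (not_lt.1 h)
  have := Nat.le_findGreatest (P := fun l => msgLen l ≤ k) h1 (not_lt.1 h)
  exact absurd this (by unfold msgLevel; omega)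

theorem msgLen_msgLevel_le {k : ℕ} (hk : 1 ≤ k) : msgLen (msgLevel k) ≤ k :=
  Nat.findGreatest_spec (P := fun l => msgLen l ≤ k) (Nat.zero_le k) (by rwa [msgLen_zero])

theorem msgLen_mono : Monotone msgLen :=
  fun _ l' h => Nat.le_of_dvd (msgLen_pos l') (msgLen_dvd h)

theorem numBlocks_le (m k : ℕ) : numBlocks m k ≤ bSeq (endLevel m k + 1) := by
  have h0 := msgLen_pos (endLevel m k)
  have h1 : k < msgLen (endLevel m k + 1) :=
    (lt_msgLen_msgLevel_succ k).trans_le (msgLen_mono (Nat.succ_le_succ (le_max_left _ _)))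
  rw [msgLen_succ] at h1
  rw [numBlocks, ← Nat.lt_succ_iff, Nat.div_lt_iff_lt_mul h0, Nat.succ_mul]
  omega

/-- If `L' ≤ L`, then `k_D ≤ k` and padding at most doubles the message. Otherwise there is at most
one block, and its length is at most `n_{L'} ≤ T_{L'} ≤ m`. -/
theorem streamLen_le {R : ℝ} (hR : 0 < R) (hRl : ∀ l, (codeLen l : ℝ) ≤ R * msgLen l) {m k : ℕ}
    (hm : 1 ≤ m) (hk : 1 ≤ k) : (streamLen m k : ℝ) ≤ 2 * R * k + m := by
  rcases le_or_gt (maxRelayLevel m) (msgLevel k) with h | h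
  · have hD : endLevel m k = msgLevel k := max_eq_left h
    have h1 : numBlocks m k * msgLen (msgLevel k) ≤ 2 * k := by
      rw [numBlocks, hD]
      have := Nat.div_mul_le_self (k + msgLen (msgLevel k) - 1) (msgLen (msgLevel k))
      have := msgLen_msgLevel_le hk
      omega
    have h1' : (numBlocks m k * msgLen (msgLevel k) : ℝ) ≤ 2 * k := by exact_mod_cast h1
    rw [streamLen, hD]
    push_cast
    calc (numBlocks m k * codeLen (msgLevel k) : ℝ)
        ≤ numBlocks m k * (R * msgLen (msgLevel k)) := by gcongr; exact hRl _
      _ = R * (numBlocks m k * msgLen (msgLevel k)) := by ring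
      _ ≤ R * (2 * k) := by gcongr
      _ ≤ _ := by linarith [(Nat.cast_nonneg m : (0 : ℝ) ≤ m)]
  · have hD : endLevel m k = maxRelayLevel m := max_eq_right h.le
    have h1 : k < msgLen (maxRelayLevel m) := (lt_msgLen_msgLevel_succ k).trans_le (msgLen_mono h)
    have h2 : numBlocks m k ≤ 1 := by
      rw [numBlocks, hD, ← Nat.lt_succ_iff, Nat.div_lt_iff_lt_mul (msgLen_pos _)]
      omega
    have h3 : codeLen (maxRelayLevel m) ≤ m := by
      refine le_trans ?_ (tProd_maxRelayLevel_le hm)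
      exact (Nat.le_mul_of_pos_right _ (by positivity)).trans (codeLen_mul_two_pow_le _)
    have h4 : streamLen m k ≤ m := by
      rw [streamLen, hD]
      calc _ ≤ 1 * m := Nat.mul_le_mul h2 h3
        _ = m := one_mul m
    have h5 : (streamLen m k : ℝ) ≤ m := by exact_mod_cast h4
    have : 0 ≤ 2 * R * k := by positivity
    linarith

theorem transmissionTime_le {R : ℝ} (hR : 0 < R) (hRl : ∀ l, (codeLen l : ℝ) ≤ R * msgLen l)
    (r : ℕ) {m k : ℕ} {β : ℝ} (hm : 1 ≤ m) (hk : 1 ≤ k) (hkm : (k : ℝ) ≤ β * m) :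
    (transmissionTime r m k : ℝ) ≤ r * (3 + 2 * R * β) * m := by
  have h1 := startTime_le r (m - 1)
  have h2 := streamLen_le hR hRl hm hk
  have h3 : ((m - 1 : ℕ) : ℝ) ≤ m := by exact_mod_cast Nat.sub_le m 1
  rw [transmissionTime]
  push_cast
  calc (startTime r (m - 1) + r * streamLen m k : ℝ)
      ≤ r * (2 * m) + r * (2 * R * (β * m) + m) := by
        refine add_le_add (h1.trans (by gcongr)) ?_
        refine mul_le_mul_of_nonneg_left (h2.trans ?_) (Nat.cast_nonneg r)
        gcongr
    _ = _ := by ring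

theorem le_transmissionTime {r : ℕ} (hr : 0 < r) (m k : ℕ) : m ≤ transmissionTime r m k + 1 := by
  have := le_startTime hr (m - 1)
  unfold transmissionTime
  omega

/-! ## The exponent -/

theorem tProd_le (l : ℕ) : tProd l ≤ (l + 2) ^ (2 * l) := by
  induction l with
  | zero => simp [tProd_zero]
  | succ l ih =>
    rw [tProd_succ, tSeq]
    calc (l + 1 + 2) ^ 2 * tProd l ≤ (l + 1 + 2) ^ 2 * (l + 1 + 2) ^ (2 * l) := by
          refine Nat.mul_le_mul_left _ (ih.trans (Nat.pow_le_pow_left (by omega) _))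
      _ = _ := by rw [← pow_add]; congr 1; ring

theorem one_le_endLevel {m : ℕ} (hm : 10 ≤ m) (k : ℕ) : 1 ≤ endLevel m k := by
  refine le_trans ?_ (le_max_right _ _)
  by_contra h
  have := le_tProd_of_maxRelayLevel_lt (not_le.1 h)
  simp [tProd, tSeq] at this
  omega

theorem le_tProd_endLevel_succ (m k : ℕ) : m ≤ tProd (endLevel m k + 1) :=
  le_tProd_of_maxRelayLevel_lt (Nat.lt_succ_of_le (le_max_right _ _))

/-- `log n / log log n` is at most of the order of the level. -/
theorem log_div_log_log_le {x E : ℝ} (hE : 1 < E) (hx : Real.exp (Real.exp 1) ≤ x)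
    (h : Real.log x ≤ 4 * E * Real.log E) :
    Real.log x / Real.log (Real.log x) ≤ 4 * E := by
  have hx0 : 0 < x := (Real.exp_pos _).trans_le hx
  have h1 : Real.exp 1 ≤ Real.log x := (Real.le_log_iff_exp_le hx0).2 hx
  have hl0 : 0 < Real.log x := (Real.exp_pos _).trans_le h1
  have h2 : 1 ≤ Real.log (Real.log x) := (Real.le_log_iff_exp_le hl0).2 h1
  rw [div_le_iff₀ (by linarith)]
  -- If `E ≤ log x`, then `log E ≤ log log x`; otherwise `log x < E` and `log log x ≥ 1` suffice.
  rcases le_or_gt E (Real.log x) with hc | hc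
  · refine h.trans (mul_le_mul_of_nonneg_left ?_ (by linarith))
    exact Real.log_le_log (by linarith) hc
  · nlinarith

/-- The constant `1/32` comes from `(1/32) · 4(D + 3) = (D + 3)/8 ≤ D/2 ≤ D log 2` for `D ≥ 1`. -/
theorem rpow_le_two_pow {x : ℝ} {D : ℕ} (hD : 1 ≤ D) (hx : Real.exp (Real.exp 1) ≤ x)
    (h : x ≤ ((D : ℝ) + 3) ^ (4 * (D + 3))) :
    x ^ ((1 / 32 : ℝ) / Real.log (Real.log x)) ≤ 2 ^ D := by
  have hx0 : 0 < x := (Real.exp_pos _).trans_le hx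
  have hD1 : (1 : ℝ) ≤ D := by exact_mod_cast hD
  have hlog : Real.log x ≤ 4 * ((D : ℝ) + 3) * Real.log ((D : ℝ) + 3) := by
    have := Real.log_le_log hx0 h
    rw [Real.log_pow] at this
    push_cast at this
    exact this
  have h1 := log_div_log_log_le (by linarith) hx hlog
  have h2 : (2 : ℝ) ^ D = Real.exp (D * Real.log 2) := by
    rw [← Real.log_pow, Real.exp_log (by positivity)]
  rw [Real.rpow_def_of_pos hx0, h2, Real.exp_le_exp]
  have hl2 := Real.log_two_gt_d9
  calc Real.log x * (1 / 32 / Real.log (Real.log x))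
      = 1 / 32 * (Real.log x / Real.log (Real.log x)) := by ring
    _ ≤ 1 / 32 * (4 * ((D : ℝ) + 3)) := by gcongr
    _ ≤ D * Real.log 2 := by nlinarith

/-- There are at most `(D+3)^2` blocks and `(D+3)^2` segments, fewer than the polynomial factor in
`failBound` allows. -/
theorem union_bound_le (m k : ℕ) :
    (numBlocks m k * (tSeq (endLevel m k + 1) * failBound (endLevel m k)) : ℝ) ≤
      Real.exp (-2 ^ endLevel m k) := by
  set D := endLevel m k with hD
  have h1 : (numBlocks m k : ℝ) ≤ ((D : ℝ) + 3) ^ 2 := by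
    have h : numBlocks m k ≤ (D + 3) ^ 2 := (numBlocks_le m k).trans (Nat.div_le_self _ _)
    exact_mod_cast h
  have h2 : (tSeq (D + 1) : ℝ) = ((D : ℝ) + 3) ^ 2 := by simp only [tSeq]; push_cast; ring
  have h3 : (1 : ℝ) ≤ (D : ℝ) + 3 := by linarith [(Nat.cast_nonneg D : (0 : ℝ) ≤ D)]
  have h4 : ((D : ℝ) + 3) ^ 4 ≤ ((D : ℝ) + 3) ^ 8 := pow_le_pow_right₀ h3 (by norm_num)
  have h5 := Real.exp_pos (-2 ^ D)
  rw [h2, failBound]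
  calc (numBlocks m k * (((D : ℝ) + 3) ^ 2 * (Real.exp (-2 ^ D) / (256 * (D + 3) ^ 8))) : ℝ)
      ≤ ((D : ℝ) + 3) ^ 2 * (((D : ℝ) + 3) ^ 2 *
          (Real.exp (-2 ^ D) / (256 * (D + 3) ^ 8))) := by gcongr
    _ = ((D : ℝ) + 3) ^ 4 / (256 * (D + 3) ^ 8) * Real.exp (-2 ^ D) := by ring
    _ ≤ 1 * Real.exp (-2 ^ D) := by
      gcongr
      rw [div_le_one (by positivity)]
      linarith [(by positivity : (0 : ℝ) ≤ ((D : ℝ) + 3) ^ 8)]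
    _ = _ := one_mul _

theorem exists_repetitions (p : unitInterval) (hp0 : 0 < (p : ℝ)) (hp : (p : ℝ) < 1 / 2) :
    ∃ r : ℕ, 0 < r ∧ 256 * (1 / 2 + 2 * (p : ℝ) * (1 - p)) ^ r ≤ failBound 1 := by
  set θ : ℝ := 1 / 2 + 2 * (p : ℝ) * (1 - p) with hθ
  have h0 : 0 ≤ θ := by nlinarith
  -- Indeed `1 - θ = 2 (1/2 - p)^2`.
  have h1 : θ < 1 := by nlinarith [mul_pos (sub_pos.2 hp) (sub_pos.2 hp)]
  have hf : 0 < failBound 1 / 256 := by unfold failBound; positivity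
  obtain ⟨n, hn⟩ := exists_pow_lt_of_lt_one hf h1
  refine ⟨n + 1, n.succ_pos, ?_⟩
  have : θ ^ (n + 1) ≤ θ ^ n := pow_le_pow_of_le_one h0 h1.le n.le_succ
  linarith

end ManyHop

theorem corollary2 (p : unitInterval) (hp0 : 0 < (p : ℝ)) (hp : (p : ℝ) < 1 / 2) :
    ∃ r : ℕ, 0 < r ∧
      ∀ α β : ℝ, 0 < α → α ≤ β →
        ∃ C c : ℝ, 0 < C ∧ 0 < c ∧ ∃ M : ℕ, ∀ m k : ℕ, M ≤ m →
          α * (m : ℝ) ≤ (k : ℝ) → (k : ℝ) ≤ β * (m : ℝ) →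
          (ManyHop.transmissionTime r m k : ℝ) ≤ C * (m : ℝ) ∧
          ∀ w : Fin k → Bool,
            (ManyHop.multiBit r m k).errorProb p m w ≤
              Real.exp (-((ManyHop.transmissionTime r m k : ℝ) ^
                (c / Real.log (Real.log (ManyHop.transmissionTime r m k : ℝ))))) := by
  obtain ⟨r, hr, hδ⟩ := ManyHop.exists_repetitions p hp0 hp
  obtain ⟨R, hR, hRl⟩ := ManyHop.exists_codeLen_le
  refine ⟨r, hr, fun α β hα hαβ => ?_⟩
  have hβ : 0 < β := hα.trans_le hαβ
  have hr0 : (0 : ℝ) < r := by exact_mod_cast hr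
  set C : ℝ := r * (3 + 2 * R * β) with hC
  -- The three summands of the bound on `m` give `m > T_1 = 9`, hence `D ≥ 1`; `C ≤ m`, hence `n ≤ m
  -- ^ 2`; and `log log n ≥ 1`.
  refine ⟨C, 1 / 32, by positivity, by norm_num,
    10 + ⌈C⌉₊ + ⌈Real.exp (Real.exp 1)⌉₊, fun m k hM hαk hkβ => ?_⟩
  have hm1 : 1 ≤ m := by omega
  have hm0 : (0 : ℝ) < m := by exact_mod_cast hm1
  have hk : 1 ≤ k := by
    have : (0 : ℝ) < k := (mul_pos hα hm0).trans_le hαk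
    exact_mod_cast this
  have htime := ManyHop.transmissionTime_le hR hRl r hm1 hk hkβ
  refine ⟨htime, fun w => ?_⟩
  have hD := ManyHop.one_le_endLevel (show 10 ≤ m by omega) k
  refine (ManyHop.errorProb_le p hm1 (fun j q =>
    ManyHop.measureReal_voteFails_le p hp0 hp r m _ j q) hδ hD w).trans
      ((ManyHop.union_bound_le m k).trans ?_)
  rw [Real.exp_le_exp, neg_le_neg_iff]
  have hCm : C ≤ m := (Nat.le_ceil C).trans (by exact_mod_cast (by omega : ⌈C⌉₊ ≤ m))
  refine ManyHop.rpow_le_two_pow hD ?_ ?_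
  · refine (Nat.le_ceil _).trans ?_
    have := ManyHop.le_transmissionTime hr m k
    exact_mod_cast (by omega : ⌈Real.exp (Real.exp 1)⌉₊ ≤ ManyHop.transmissionTime r m k)
  · set D := ManyHop.endLevel m k
    have hmD : m ≤ (D + 3) ^ (2 * (D + 3)) :=
      ((ManyHop.le_tProd_endLevel_succ m k).trans (ManyHop.tProd_le _)).trans
        (Nat.pow_le_pow_right (by omega) (by omega))
    have hmD' : (m : ℝ) ≤ ((D : ℝ) + 3) ^ (2 * (D + 3)) := by exact_mod_cast hmD
    calc (ManyHop.transmissionTime r m k : ℝ) ≤ C * m := htime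
      _ ≤ ((D : ℝ) + 3) ^ (2 * (D + 3)) * ((D : ℝ) + 3) ^ (2 * (D + 3)) := by
        gcongr
        exact hCm.trans hmD'
      _ = _ := by rw [← pow_add]; congr 1; ring
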